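/- **Setting.** Let $n\ge 1$, $\gamma\in\mathbb C\setminus\{0\}$, $V=\mathbb C^n$ with matrix units $e_{ij}$, dynamical variables $\lambda=(\lambda_1,\dots,\lambda_n)\in\mathbb C^n$, $\lambda_{ij}=\lambda_i-\lambda_j$, $\sigma=\sum_k\lambda_k$, and spectral parameters $u,v,w\in\mathbb C$ attached to the tensor factors $1,2,3$. For a matrix function $M$ put $M_1=M\otimes 1$, $M_2=1\otimes M$; $M_{21}$ is $M_{12}$ with the two factors exchanged. Let $\lambda+\gamma h^j$ be $\lambda$ with $\lambda_j$ replaced by $\lambda_j+\gamma$, and $M_2(h_1)=\sum_j e_{jj}\otimes M(\lambda+\gamma h^j)$, $M_1(h_2)=\sum_j M(\lambda+\gamma h^j)\otimes e_{jj}$, $M_{12}(h_3)=\sum_j M(\lambda+\gamma h^j)\otimes e_{jj}$. Let $g=\exp(-\gamma\,\frac{d}{du})$, so that $g^t=\exp(t\log g)$ is the translation $u\mapsto u-t\gamma$; $M^g(u)=M(u-\gamma)$ and, for a function of two spectral parameters, $M^{gg}(u,v)=M(u-\gamma,v-\gamma)$. The rational non-constant ACF matrices are $$A_{12}(u,v;\lambda)=1+\sum_{i\ne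 j}x_{ij}(e_{ii}-e_{ij})\otimes(e_{jj}-e_{ji})+\tfrac{\gamma}{u-v}\,\mathsf d_{12}+\tfrac{\gamma}{v}\,\mathsf b_{12}-\tfrac{\gamma}{u+\gamma}\,\mathsf b_{21},$$ $$B_{12}(v;\lambda)=1+\sum_{i\ne j}y_{ij}\,e_{jj}\otimes(e_{ii}-e_{ij})-\tfrac{\gamma}{v+\gamma}\,\mathsf b_{12},\qquad C_{12}(u;\lambda)=B_{21}(u;\lambda),$$ $$D_{12}(u-v;\lambda)=1+\sum_{i\ne j}x_{ij}(e_{ij}\otimes e_{ji}-e_{ii}\otimes e_{jj})+\tfrac{\gamma}{u-v}\,\mathsf d_{12},$$ with $\mathsf d_{12}=\sum_{i,j}e_{ij}\otimes e_{ji}$, $\mathsf b_{12}=\sum_{i,j}e_{ii}\otimes e_{ji}$, $x_{ij}=\gamma/\lambda_{ij}$, $y_{ij}=\gamma/(\lambda_{ij}-\gamma)$. The twist $b=b(u;\lambda)$ is, for $1\le j\le n$, $$b_{ij}=\frac{\lambda_j^{\,i-1}}{\prod_{a\ne j}\lambda_{ja}}\quad(1\le i\le n-1),\qquad b_{nj}=\frac{\lambda_j^{\,n-1}(\sigma-\lambda_j+u+\gamma)}{(\sigma+u+f_0)\prod_{a\ne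 j}\lambda_{ja}},$$ where $f_0$ is a function of $\sigma+u$. For constant $f_0$, writing $U=\sigma+u+f_0$ and $W=\sigma+v+f_0$, put $$\begin{aligned}R(u,v;\lambda)={}&\Big(1+\tfrac{\gamma}{u-v}\Big)\Big[\sum_{i=1}^{n-1}e_{ii}\otimes e_{ii}+\tfrac{W(U-\gamma)}{U(W-\gamma)}\,e_{nn}\otimes e_{nn}\Big]+\sum_{\substack{i,j=1\\ i\ne j}}^{n-1}e_{ii}\otimes e_{jj}\\&+\tfrac{W}{W-\gamma}\sum_{i=1}^{n-1}e_{ii}\otimes e_{nn}+\tfrac{U-\gamma}{U}\sum_{i=1}^{n-1}e_{nn}\otimes e_{ii}\\&+\gamma\tfrac{\sigma+u+\gamma}{U}\sum_{k=1}^{n-1}\sum_{j=1}^{n-k}e_{n,n-k}\otimes e_{j,j+k-1}-\gamma\tfrac{\sigma+v}{W-\gamma}\sum_{k=1}^{n-1}\sum_{j=1}^{n-k}e_{j,j+k-1}\otimes e_{n,n-k}\\&+\gamma\sum_{i=1}^{n-1}\sum_{k=1}^{i-1}\sum_{j=1}^{i-k}\big(e_{i,i-k}\otimes e_{j,j+k-1}-e_{j,j+k-1}\otimes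 e_{i,i-k}\big)+\tfrac{\gamma}{u-v}\sum_{\substack{i,j=1\\ i\ne j}}^{n-1}e_{ij}\otimes e_{ji}\\&+\tfrac{\gamma}{u-v}\tfrac{U-\gamma}{W-\gamma}\sum_{i=1}^{n-1}e_{in}\otimes e_{ni}+\tfrac{\gamma}{u-v}\tfrac{W}{U}\sum_{i=1}^{n-1}e_{ni}\otimes e_{in}\\&-\tfrac{\gamma}{U}\sum_{i=1}^{n-1}\sum_{k=1}^{n-1-i}e_{n,n-i}\otimes e_{k,k+i}+\tfrac{\gamma}{W-\gamma}\sum_{i=1}^{n-1}\sum_{k=1}^{n-1-i}e_{k,k+i}\otimes e_{n,n-i}.\end{aligned}$$ Finally, put $$\begin{aligned}R^0(u,v)={}&\Big(1+\tfrac{\gamma}{u-v}\Big)\Big[\sum_{i=1}^{n-1}e_{ii}\otimes e_{ii}+\tfrac{u(v+\gamma)}{v(u+\gamma)}\,e_{nn}\otimes e_{nn}\Big]+\sum_{\substack{i,j=1\\ i\ne j}}^{n-1}e_{ii}\otimes e_{jj}\\&+\tfrac{v+\gamma}{v}\sum_{i=1}^{n-1}e_{ii}\otimes e_{nn}+\tfrac{u}{u+\gamma}\sum_{i=1}^{n-1}e_{nn}\otimes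 e_{ii}\\&+\gamma\sum_{i=1}^{n}\sum_{k=1}^{i-1}\sum_{j=1}^{i-k}\big(e_{i,i-k}\otimes e_{j,j+k-1}-e_{j,j+k-1}\otimes e_{i,i-k}\big)+\tfrac{\gamma}{u-v}\sum_{\substack{i,j=1\\ i\ne j}}^{n-1}e_{ij}\otimes e_{ji}\\&+\tfrac{\gamma}{u-v}\tfrac{u}{v}\sum_{i=1}^{n-1}e_{in}\otimes e_{ni}+\tfrac{\gamma}{u-v}\tfrac{v+\gamma}{u+\gamma}\sum_{i=1}^{n-1}e_{ni}\otimes e_{in}\\&-\tfrac{\gamma}{u+\gamma}\sum_{i=1}^{n-1}\sum_{k=1}^{n-1-i}e_{n,n-i}\otimes e_{k,k+i}+\tfrac{\gamma}{v}\sum_{i=1}^{n-1}\sum_{k=1}^{n-1-i}e_{k,k+i}\otimes e_{n,n-i}.\end{aligned}$$ **Claim.** 1. For every function $f_0$, $b(u;\lambda)$ is invertible whenever the $\lambda_i$ are pairwise distinct, $u+\gamma\ne0$ and $\sigma+u+f_0\ne0$. If moreover $\lambda_{ij}\ne\gamma$ for all $i\neq j$, then $B_{12}=b_2^{-1}\,b_2^{g}(h_1)$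 and $C_{12}=b_1^{-1}\,b_1^{g}(h_2)$. 2. For constant $f_0$, $$A_{12}=b_1^{-1}\,(b_2^{g})^{-1}\,R_{12}\,b_1^{g}\,b_2$$ whenever the $\lambda_i$ are pairwise distinct, $u\ne v$, $u+\gamma\neq0$, $v\ne0$, and $U,W,U-\gamma,W-\gamma$ are nonzero. 3. For constant $f_0$, $$D_{12}=(b_1^{g})^{-1}(h_2)\,(b_2^{g})^{-1}\,R_{12}\,b_1^{g}\,b_2^{g}(h_1)$$ whenever $\lambda_{ij}\notin\{0,\gamma\}$ for all $i\ne j$, $u\neq v$, $u\ne0$, $v\ne0$, and $U,W,U-\gamma,W-\gamma$ are nonzero. 4. For constant $f_0$, $R$ is quasi non-dynamical: $R_{12}=R_{12}^{gg}(h_3)$ whenever $u\neq v$ and $U$, $W-\gamma$ are nonzero. 5. For $f_0=\gamma$, $R$ is de-dynamized to $R^0$: $$R_{12}=e^{-\frac{\sigma}{\gamma}(\log g_1+\log g_2)}\,R^0_{12}\,e^{\frac{\sigma}{\gamma}(\log g_1+\log g_2)},$$ that is, $R(u,v;\lambda)=R^0(u+\sigma,v+\sigma)$, whenever $u\ne v$,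 $\sigma+u+\gamma\neq0$ and $\sigma+v\ne0$. 6. $R^0$ depends on $u$ and $v$ separately: there is no function $F$ with $R^0(u,v)=F(u-v)$ for all $u,v$ with $u\ne v$, $u+\gamma\ne0$, $v\ne0$. 7. $R^0$ solves the $g$-deformed Yang–Baxter equation $$R^0_{12}\,R^0_{13}{}^{gg}\,R^0_{23}=R^0_{23}{}^{gg}\,R^0_{13}\,R^0_{12}{}^{gg}$$ for all pairwise distinct $u,v,w$ with $u\notin\{0,-\gamma\}$, $v\notin\{0,\gamma,-\gamma\}$, $w\notin\{0,\gamma\}$. -/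

import Mathlib

open scoped Kronecker

noncomputable section

namespace ACF

/-- Operators on `V`, `V ⊗ V`, `V ⊗ V ⊗ V`, where `V = ℂⁿ`, as matrices in the standard basis. -/
abbrev Mat (n : ℕ) := Matrix (Fin n) (Fin n) ℂ
abbrev Mat2 (n : ℕ) := Matrix (Fin n × Fin n) (Fin n × Fin n) ℂ
abbrev Mat3 (n : ℕ) := Matrix (Fin n × Fin n × Fin n) (Fin n × Fin n × Fin n) ℂ

/-- The elementary matrix `e_{ij}`, indices in `Fin n`. -/
def e {n : ℕ} (i j : Fin n) : Mat n := Matrix.single i j 1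

/-- The elementary matrix `e_{ij}` with natural-number indices `1 ≤ i, j ≤ n`. -/
def E (n i j : ℕ) : Mat n :=
  Matrix.of fun a b => if (a : ℕ) + 1 = i ∧ (b : ℕ) + 1 = j then 1 else 0

/-! ### Spaces, spectral shift, dynamical shift -/

/-- `M₁ = M ⊗ 1`. -/
def sp1 {n : ℕ} (M : Mat n) : Mat2 n := M ⊗ₖ (1 : Mat n)

/-- `M₂ = 1 ⊗ M`. -/
def sp2 {n : ℕ} (M : Mat n) : Mat2 n := (1 : Mat n) ⊗ₖ M

/-- `M₂₁`: exchange of the two tensor factors. -/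
def flip {n : ℕ} (M : Mat2 n) : Mat2 n := M.submatrix Prod.swap Prod.swap

/-- `M₁₂` on the triple tensor product. -/
def leg12 {n : ℕ} (M : Mat2 n) : Mat3 n :=
  Matrix.of fun p q => if p.2.2 = q.2.2 then M (p.1, p.2.1) (q.1, q.2.1) else 0

/-- `M₁₃` on the triple tensor product. -/
def leg13 {n : ℕ} (M : Mat2 n) : Mat3 n :=
  Matrix.of fun p q => if p.2.1 = q.2.1 then M (p.1, p.2.2) (q.1, q.2.2) else 0

/-- `M₂₃` on the triple tensor product. -/
def leg23 {n : ℕ} (M : Mat2 n) : Mat3 n :=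
  Matrix.of fun p q => if p.1 = q.1 then M (p.2.1, p.2.2) (q.2.1, q.2.2) else 0

/-- Conjugation `g^t M g^{-t}` of a function of the spectral parameter, where
`g = exp(-γ d/du)`, so that `g^t = exp(t log g) = exp(-t γ d/du)` is the translation
`u ↦ u - t γ`.  In particular `M^g = gConj γ 1 M`. -/
def gConj {X : Type*} (γ t : ℂ) (M : ℂ → X) : ℂ → X := fun u => M (u - t * γ)

/-- Conjugation `(g₁ g₂)^t M (g₁ g₂)^{-t}` of a function of two spectral parameters;
`M^{gg} = gConj2 γ 1 M`. -/
def gConj2 {X : Type*} (γ t : ℂ) (M : ℂ → ℂ → X) : ℂ → ℂ → X :=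
  fun u v => M (u - t * γ) (v - t * γ)

/-- `λ + γ h` on the `j`-th weight space: `λ_j` is replaced by `λ_j + γ`. -/
def shift {n : ℕ} (γ : ℂ) (j : Fin n) (lam : Fin n → ℂ) : Fin n → ℂ := lam + Pi.single j γ

/-- `M₂(h₁) = ∑_j e_{jj} ⊗ M(λ + γ h^j)`. -/
def dyn2h1 {n : ℕ} (γ : ℂ) (M : (Fin n → ℂ) → Mat n) (lam : Fin n → ℂ) : Mat2 n :=
  ∑ j : Fin n, e j j ⊗ₖ M (shift γ j lam)

/-- `M₁(h₂) = ∑_j M(λ + γ h^j) ⊗ e_{jj}`. -/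
def dyn1h2 {n : ℕ} (γ : ℂ) (M : (Fin n → ℂ) → Mat n) (lam : Fin n → ℂ) : Mat2 n :=
  ∑ j : Fin n, M (shift γ j lam) ⊗ₖ e j j

/-- `M₁₂(h₃) = ∑_j M(λ + γ h^j) ⊗ e_{jj}` on the triple tensor product. -/
def dyn12h3 {n : ℕ} (γ : ℂ) (M : (Fin n → ℂ) → Mat2 n) (lam : Fin n → ℂ) : Mat3 n :=
  Matrix.of fun p q =>
    if p.2.2 = q.2.2 then M (shift γ p.2.2 lam) (p.1, p.2.1) (q.1, q.2.1) else 0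

/-! ### The rational non-constant Arutyunov-Chekhov-Frolov structure matrices -/

def x {n : ℕ} (γ : ℂ) (lam : Fin n → ℂ) (i j : Fin n) : ℂ := γ / (lam i - lam j)

def y {n : ℕ} (γ : ℂ) (lam : Fin n → ℂ) (i j : Fin n) : ℂ := γ / (lam i - lam j - γ)

/-- `d₁₂ = ∑ e_{ij} ⊗ e_{ji}`, the permutation matrix. -/
def dMat (n : ℕ) : Mat2 n := ∑ i : Fin n, ∑ j : Fin n, e i j ⊗ₖ e j i

/-- `b₁₂ = ∑ e_{ii} ⊗ e_{ji}`. -/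
def bMat (n : ℕ) : Mat2 n := ∑ i : Fin n, ∑ j : Fin n, e i i ⊗ₖ e j i

def Ainf {n : ℕ} (γ : ℂ) (lam : Fin n → ℂ) : Mat2 n :=
  1 + ∑ i : Fin n, ∑ j ∈ Finset.univ.erase i,
    x γ lam i j • ((e i i - e i j) ⊗ₖ (e j j - e j i))

def Binf {n : ℕ} (γ : ℂ) (lam : Fin n → ℂ) : Mat2 n :=
  1 + ∑ i : Fin n, ∑ j ∈ Finset.univ.erase i,
    y γ lam i j • (e j j ⊗ₖ (e i i - e i j))

def Dinf {n : ℕ} (γ : ℂ) (lam : Fin n → ℂ) : Mat2 n :=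
  1 + ∑ i : Fin n, ∑ j ∈ Finset.univ.erase i,
    x γ lam i j • (e i j ⊗ₖ e j i - e i i ⊗ₖ e j j)

def A {n : ℕ} (γ u v : ℂ) (lam : Fin n → ℂ) : Mat2 n :=
  Ainf γ lam + (γ / (u - v)) • dMat n + (γ / v) • bMat n - (γ / (u + γ)) • flip (bMat n)

def B {n : ℕ} (γ v : ℂ) (lam : Fin n → ℂ) : Mat2 n :=
  Binf γ lam - (γ / (v + γ)) • bMat n

/-- `C₁₂(u; λ) = B₂₁(u; λ)`. -/
def C {n : ℕ} (γ u : ℂ) (lam : Fin n → ℂ) : Mat2 n := flip (B γ u lam)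

/-- `D₁₂(s; λ)`, where `s` is the difference of the spectral parameters. -/
def D {n : ℕ} (γ s : ℂ) (lam : Fin n → ℂ) : Mat2 n :=
  Dinf γ lam + (γ / s) • dMat n

/-! ### The twist and the `R`-matrices -/

/-- `σ = ∑ λ_k`. -/
def sigma {n : ℕ} (lam : Fin n → ℂ) : ℂ := ∑ k : Fin n, lam k

/-- The twist `b(u; λ)`; `f₀` is a function of `σ + u`.  Row `i : Fin n` is row number `i + 1`. -/
def twist {n : ℕ} (γ : ℂ) (f0 : ℂ → ℂ) (u : ℂ) (lam : Fin n → ℂ) : Mat n :=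
  Matrix.of fun i j =>
    if (i : ℕ) + 1 = n then
      lam j ^ (i : ℕ) * (sigma lam - lam j + u + γ) /
        ((∏ a ∈ Finset.univ.erase j, (lam j - lam a)) *
          (sigma lam + u + f0 (sigma lam + u)))
    else
      lam j ^ (i : ℕ) / ∏ a ∈ Finset.univ.erase j, (lam j - lam a)

/-- The quasi non-dynamical matrix `R(u, v; λ)`, with constant `f₀`. -/
def R {n : ℕ} (γ f0 u v : ℂ) (lam : Fin n → ℂ) : Mat2 n :=
  let σ := sigma lam
  (1 + γ / (u - v)) • ∑ i ∈ Finset.Icc 1 (n - 1), E n i i ⊗ₖ E n i i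
  + ((1 + γ / (u - v)) * ((σ + v + f0) * (σ + u - γ + f0)
      / ((σ + u + f0) * (σ + v - γ + f0)))) • (E n n n ⊗ₖ E n n n)
  + ∑ i ∈ Finset.Icc 1 (n - 1), ∑ j ∈ (Finset.Icc 1 (n - 1)).erase i, E n i i ⊗ₖ E n j j
  + ((σ + v + f0) / (σ + v - γ + f0)) •
      ∑ i ∈ Finset.Icc 1 (n - 1), E n i i ⊗ₖ E n n n
  + ((σ + u - γ + f0) / (σ + u + f0)) •
      ∑ i ∈ Finset.Icc 1 (n - 1), E n n n ⊗ₖ E n i i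
  + (γ * ((σ + u + γ) / (σ + u + f0))) •
      ∑ k ∈ Finset.Icc 1 (n - 1), ∑ j ∈ Finset.Icc 1 (n - k),
        E n n (n - k) ⊗ₖ E n j (j + k - 1)
  - (γ * ((σ + v) / (σ + v - γ + f0))) •
      ∑ k ∈ Finset.Icc 1 (n - 1), ∑ j ∈ Finset.Icc 1 (n - k),
        E n j (j + k - 1) ⊗ₖ E n n (n - k)
  + γ • ∑ i ∈ Finset.Icc 1 (n - 1), ∑ k ∈ Finset.Icc 1 (i - 1), ∑ j ∈ Finset.Icc 1 (i - k),
      (E n i (i - k) ⊗ₖ E n j (j + k - 1) - E n j (j + k - 1) ⊗ₖ E n i (i - k))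
  + (γ / (u - v)) •
      ∑ i ∈ Finset.Icc 1 (n - 1), ∑ j ∈ (Finset.Icc 1 (n - 1)).erase i, E n i j ⊗ₖ E n j i
  + (γ / (u - v) * ((σ + u - γ + f0) / (σ + v - γ + f0))) •
      ∑ i ∈ Finset.Icc 1 (n - 1), E n i n ⊗ₖ E n n i
  + (γ / (u - v) * ((σ + v + f0) / (σ + u + f0))) •
      ∑ i ∈ Finset.Icc 1 (n - 1), E n n i ⊗ₖ E n i n
  - (γ / (σ + u + f0)) •
      ∑ i ∈ Finset.Icc 1 (n - 1), ∑ k ∈ Finset.Icc 1 (n - 1 - i),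
        E n n (n - i) ⊗ₖ E n k (k + i)
  + (γ / (σ + v - γ + f0)) •
      ∑ i ∈ Finset.Icc 1 (n - 1), ∑ k ∈ Finset.Icc 1 (n - 1 - i),
        E n k (k + i) ⊗ₖ E n n (n - i)

/-- The non-dynamical matrix `R⁰(u, v)`. -/
def R0 (n : ℕ) (γ u v : ℂ) : Mat2 n :=
  (1 + γ / (u - v)) • ∑ i ∈ Finset.Icc 1 (n - 1), E n i i ⊗ₖ E n i i
  + ((1 + γ / (u - v)) * (u * (v + γ) / (v * (u + γ)))) • (E n n n ⊗ₖ E n n n)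
  + ∑ i ∈ Finset.Icc 1 (n - 1), ∑ j ∈ (Finset.Icc 1 (n - 1)).erase i, E n i i ⊗ₖ E n j j
  + ((v + γ) / v) • ∑ i ∈ Finset.Icc 1 (n - 1), E n i i ⊗ₖ E n n n
  + (u / (u + γ)) • ∑ i ∈ Finset.Icc 1 (n - 1), E n n n ⊗ₖ E n i i
  + γ • ∑ i ∈ Finset.Icc 1 n, ∑ k ∈ Finset.Icc 1 (i - 1), ∑ j ∈ Finset.Icc 1 (i - k),
      (E n i (i - k) ⊗ₖ E n j (j + k - 1) - E n j (j + k - 1) ⊗ₖ E n i (i - k))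
  + (γ / (u - v)) •
      ∑ i ∈ Finset.Icc 1 (n - 1), ∑ j ∈ (Finset.Icc 1 (n - 1)).erase i, E n i j ⊗ₖ E n j i
  + (γ / (u - v) * (u / v)) • ∑ i ∈ Finset.Icc 1 (n - 1), E n i n ⊗ₖ E n n i
  + (γ / (u - v) * ((v + γ) / (u + γ))) • ∑ i ∈ Finset.Icc 1 (n - 1), E n n i ⊗ₖ E n i n
  - (γ / (u + γ)) •
      ∑ i ∈ Finset.Icc 1 (n - 1), ∑ k ∈ Finset.Icc 1 (n - 1 - i),
        E n n (n - i) ⊗ₖ E n k (k + i)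
  + (γ / v) •
      ∑ i ∈ Finset.Icc 1 (n - 1), ∑ k ∈ Finset.Icc 1 (n - 1 - i),
        E n k (k + i) ⊗ₖ E n n (n - i)

/-- Points where `λ_i ≠ λ_j` and `λ_i - λ_j ≠ γ` for all `i ≠ j`. -/
def Generic {n : ℕ} (γ : ℂ) (lam : Fin n → ℂ) : Prop :=
  ∀ i j : Fin n, i ≠ j → lam i - lam j ≠ 0 ∧ lam i - lam j ≠ γ

end ACF

end

/-!
In a diagonal gauge the entries of `R` are polynomials in `p = σ + u + γ` and `q = σ + v`, up to a
multiple of the permutation. Its action on a vector `(1, X, …, X ^ (n - 2), X ^ (n - 1) * (p - X))`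
tensored with the analogous vector for `q` and `Y` is by divided differences: it combines the labels
`(X, Y)` and `(Y, X)` with the scalar coefficients of a rational `R`-matrix, and shifts `p` and `q`
by `γ`.

In the same gauge the columns of the twist are these vectors at the nodes `λ_j`, weighted by the
Lagrange weights of the nodes. The parametrizations of `A`, `B`, `C` and `D` therefore become
identities between Lagrange sums; on the diagonal `i = j` the coefficients of `R` degenerate to
derivatives. Since generic label vectors span, the deformed Yang–Baxter equation becomes an identity
between scalar coefficients on the six permutations of three labels `X, Y, Z`; the shifts of `p` and
`q` are what forces the conjugations by `g`.
-/

noncomputable section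

namespace ACF

open scoped Matrix Polynomial

/-! ### Decomposable tensors -/

/-- The decomposable tensor `x ⊗ y` of two coordinate vectors, as a function on pairs of indices and
bilinear in `x` and `y`; a triple tensor is `x ⊠ (y ⊠ z)`, in accordance with `Mat3`. -/
def tmul {K ι κ : Type*} [CommSemiring K] : (ι → K) →ₗ[K] (κ → K) →ₗ[K] (ι × κ → K) :=
  LinearMap.mk₂ K (fun x y t => x t.1 * y t.2)
    (fun _ _ _ => funext fun _ => add_mul _ _ _) (fun _ _ _ => funext fun _ => mul_assoc _ _ _)
    (fun _ _ _ => funext fun _ => mul_add _ _ _) (fun _ _ _ => funext fun _ => mul_left_comm _ _ _)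

local infixr:70 "⊠" => tmul

section Tensor

variable {K ι κ μ m n : Type*} [CommSemiring K]

theorem tmul_apply (x : ι → K) (y : κ → K) (t : ι × κ) : (x ⊠ y) t = x t.1 * y t.2 := rfl

theorem tmul_comp_swap (x : ι → K) (y : κ → K) : (x ⊠ y) ∘ Prod.swap = y ⊠ x :=
  funext fun _ => mul_comm _ _

theorem kronecker_mulVec_tmul [Fintype ι] [Fintype κ] (M : Matrix m ι K) (N : Matrix n κ K)
    (x : ι → K) (y : κ → K) : (M ⊗ₖ N) *ᵥ (x ⊠ y) = (M *ᵥ x) ⊠ (N *ᵥ y) := by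
  ext t
  simp only [Matrix.mulVec, dotProduct, Matrix.kroneckerMap_apply, tmul_apply, Finset.sum_mul_sum,
    Fintype.sum_prod_type, mul_mul_mul_comm]

theorem single_tmul_single [DecidableEq ι] [DecidableEq κ] (i : ι) (j : κ) :
    (Pi.single i 1 : ι → K) ⊠ (Pi.single j 1 : κ → K) = Pi.single (i, j) 1 := by
  ext t
  simp only [tmul_apply, Pi.single_apply, Prod.ext_iff, ite_and, ite_mul, one_mul, zero_mul]

theorem ext_mulVec_single_tmul_single [Fintype ι] [Fintype κ] [DecidableEq ι] [DecidableEq κ]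
    {M N : Matrix m (ι × κ) K}
    (h : ∀ i j, M *ᵥ tmul (Pi.single i 1) (Pi.single j 1) =
      N *ᵥ tmul (Pi.single i 1) (Pi.single j 1)) :
    M = N := by
  ext s ⟨i, j⟩
  simpa only [single_tmul_single, Matrix.mulVec_single_one, Matrix.col_apply] using
    congrFun (h i j) s

end Tensor

section Operators

variable {n : ℕ}

theorem e_mulVec (i j : Fin n) (x : Fin n → ℂ) : e i j *ᵥ x = x j • Pi.single i 1 := by
  rw [e, Matrix.single_mulVec_eq, one_mul]

theorem sp1_mulVec_tmul (M : Mat n) (x y : Fin n → ℂ) : sp1 M *ᵥ (x ⊠ y) = (M *ᵥ x) ⊠ y := by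
  rw [sp1, kronecker_mulVec_tmul, Matrix.one_mulVec]

theorem sp2_mulVec_tmul (M : Mat n) (x y : Fin n → ℂ) : sp2 M *ᵥ (x ⊠ y) = x ⊠ (M *ᵥ y) := by
  rw [sp2, kronecker_mulVec_tmul, Matrix.one_mulVec]

theorem flip_mulVec (M : Mat2 n) (w : Fin n × Fin n → ℂ) :
    flip M *ᵥ w = (M *ᵥ (w ∘ Prod.swap)) ∘ Prod.swap :=
  Matrix.submatrix_mulVec_equiv M w Prod.swap (Equiv.prodComm _ _)

theorem dyn2h1_mulVec (γ : ℂ) (M : (Fin n → ℂ) → Mat n) (lam : Fin n → ℂ) (p : Fin n)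
    (y : Fin n → ℂ) :
    dyn2h1 γ M lam *ᵥ (Pi.single p 1 ⊠ y) = Pi.single p 1 ⊠ (M (shift γ p lam) *ᵥ y) := by
  rw [dyn2h1, Matrix.sum_mulVec, Finset.sum_eq_single p]
  · rw [kronecker_mulVec_tmul, e_mulVec, Pi.single_eq_same, one_smul]
  · intro j _ hj
    rw [kronecker_mulVec_tmul, e_mulVec, Pi.single_eq_of_ne hj, zero_smul, map_zero,
      LinearMap.zero_apply]
  · exact fun h => absurd (Finset.mem_univ p) h

theorem dyn1h2_eq_flip (γ : ℂ) (M : (Fin n → ℂ) → Mat n) (lam : Fin n → ℂ) :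
    dyn1h2 γ M lam = flip (dyn2h1 γ M lam) := by
  ext s t
  simp only [dyn1h2, dyn2h1, flip, Matrix.sum_apply, Matrix.submatrix_apply,
    Matrix.kroneckerMap_apply, Prod.fst_swap, Prod.snd_swap, mul_comm]

theorem sp1_eq_flip (M : Mat n) : sp1 M = flip (sp2 M) := by
  ext s t
  exact mul_comm _ _

theorem flip_mul (M N : Mat2 n) : flip (M * N) = flip M * flip N :=
  (Matrix.submatrix_mul_equiv M N Prod.swap (Equiv.prodComm _ _) Prod.swap).symm

theorem e_kronecker_e_mulVec (i j k l p q : Fin n) :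
    (e i j ⊗ₖ e k l) *ᵥ (Pi.single p 1 ⊠ Pi.single q 1) =
      if j = p then if l = q then Pi.single i 1 ⊠ Pi.single k 1 else 0 else 0 := by
  simp only [kronecker_mulVec_tmul, e_mulVec, Pi.single_apply, ite_smul, one_smul, zero_smul]
  split_ifs <;> simp only [map_zero, LinearMap.zero_apply]

theorem dMat_mulVec (p q : Fin n) :
    dMat n *ᵥ (Pi.single p 1 ⊠ Pi.single q 1) = Pi.single q 1 ⊠ Pi.single p 1 := by
  simp only [dMat, Matrix.sum_mulVec, e_kronecker_e_mulVec, Finset.sum_ite_eq', Finset.mem_univ,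
    if_true]

theorem bMat_mulVec (p q : Fin n) :
    bMat n *ᵥ (Pi.single p 1 ⊠ Pi.single q 1) = if p = q then Pi.single p 1 ⊠ 1 else 0 := by
  have hone : ∑ j : Fin n, Pi.single j (1 : ℂ) = 1 := Finset.univ_sum_single 1
  simp only [bMat, Matrix.sum_mulVec, e_kronecker_e_mulVec, Finset.sum_ite_irrel,
    Finset.sum_ite_eq', Finset.mem_univ, if_true, ← map_sum, hone, Finset.sum_const_zero]

theorem tmul_eq_sum (x y : Fin n → ℂ) : x ⊠ y = ∑ j, y j • (x ⊠ Pi.single j 1) := by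
  conv_lhs => rw [pi_eq_sum_univ' y]
  simp only [map_sum, map_smul]

theorem tmul_eq_sum' (x y : Fin n → ℂ) : x ⊠ y = ∑ i, x i • (Pi.single i 1 ⊠ y) := by
  conv_lhs => rw [pi_eq_sum_univ' x]
  simp only [map_sum, map_smul, LinearMap.sum_apply, LinearMap.smul_apply]

theorem sum_erase_x_smul {X : Type*} [AddCommGroup X] [Module ℂ X] (γ : ℂ) (lam : Fin n → ℂ)
    (i : Fin n) (f : Fin n → X) :
    ∑ j ∈ Finset.univ.erase i, x γ lam i j • f j = ∑ j, x γ lam i j • f j :=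
  Finset.sum_erase _ (by rw [x, sub_self, div_zero, zero_smul])

theorem Ainf_mulVec (γ : ℂ) (lam : Fin n → ℂ) (p q : Fin n) :
    Ainf γ lam *ᵥ (Pi.single p 1 ⊠ Pi.single q 1) =
      (1 + x γ lam p q) • (Pi.single p 1 ⊠ Pi.single q 1) +
      x γ lam q p • (Pi.single q 1 ⊠ Pi.single p 1) -
      if p = q then Pi.single p 1 ⊠ x γ lam p + (fun c => x γ lam c p) ⊠ Pi.single p 1 else 0 := by
  simp only [Ainf, sum_erase_x_smul, Matrix.add_mulVec, Matrix.one_mulVec, Matrix.sum_mulVec,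
    Matrix.smul_mulVec, kronecker_mulVec_tmul, Matrix.sub_mulVec, e_mulVec, map_sub,
    LinearMap.sub_apply, map_smul, LinearMap.smul_apply, smul_sub, Finset.sum_sub_distrib]
  simp only [Pi.single_apply, ite_smul, smul_ite, one_smul, zero_smul, smul_zero,
    Finset.sum_ite_irrel, Finset.sum_ite_eq', Finset.sum_const_zero, Finset.mem_univ, if_true,
    tmul_eq_sum _ (x γ lam p), tmul_eq_sum' (fun c => x γ lam c p)]
  split_ifs with h
  · subst h
    module
  · module

theorem A_mulVec (γ u v : ℂ) (lam : Fin n → ℂ) (p q : Fin n) :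
    A γ u v lam *ᵥ (Pi.single p 1 ⊠ Pi.single q 1) =
      (1 + x γ lam p q) • (Pi.single p 1 ⊠ Pi.single q 1) +
      (γ / (u - v) + x γ lam q p) • (Pi.single q 1 ⊠ Pi.single p 1) +
      if p = q then Pi.single p 1 ⊠ ((γ / v) • 1 - x γ lam p) -
        ((γ / (u + γ)) • 1 + fun c => x γ lam c p) ⊠ Pi.single p 1 else 0 := by
  simp only [A, Matrix.add_mulVec, Matrix.sub_mulVec, Matrix.smul_mulVec, Ainf_mulVec,
    dMat_mulVec, flip_mulVec, tmul_comp_swap, bMat_mulVec]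
  rcases eq_or_ne p q with rfl | h
  · simp only [if_true, tmul_comp_swap, map_add, map_sub, map_smul, LinearMap.add_apply,
      LinearMap.smul_apply]
    module
  · simp only [if_neg h, if_neg h.symm, Pi.zero_comp, smul_zero]
    module

theorem B_mulVec (γ v : ℂ) (lam : Fin n → ℂ) (p q : Fin n) :
    B γ v lam *ᵥ (Pi.single p 1 ⊠ Pi.single q 1) =
      (Pi.single p 1 : Fin n → ℂ) ⊠ ((1 + y γ lam q p) • Pi.single q 1 -
        if p = q then (fun i => y γ lam i p) + (γ / (v + γ)) • 1 else 0) := by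
  have hsum (i : Fin n) : ∑ j ∈ Finset.univ.erase i, y γ lam i j • (e j j ⊗ₖ (e i i - e i j)) =
      ∑ j, y γ lam i j • (e j j ⊗ₖ (e i i - e i j)) :=
    Finset.sum_erase _ (by rw [sub_self, Matrix.kronecker_zero, smul_zero])
  simp only [B, Binf, hsum, Matrix.add_mulVec, Matrix.one_mulVec, Matrix.sum_mulVec,
    Matrix.smul_mulVec, kronecker_mulVec_tmul, Matrix.sub_mulVec, bMat_mulVec, e_mulVec, map_sub,
    map_smul, LinearMap.smul_apply, smul_sub, Finset.sum_sub_distrib]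
  simp only [Pi.single_apply, ite_smul, smul_ite, one_smul, zero_smul, smul_zero,
    Finset.sum_ite_irrel, Finset.sum_ite_eq', Finset.sum_const_zero, Finset.mem_univ, if_true]
  split_ifs with h
  · simp only [map_add, map_smul, tmul_eq_sum _ (fun i => y γ lam i p)]
    module
  · simp only [map_zero]
    module

theorem D_mulVec (γ s : ℂ) (lam : Fin n → ℂ) (p q : Fin n) :
    D γ s lam *ᵥ (Pi.single p 1 ⊠ Pi.single q 1) =
      (1 - x γ lam p q) • (Pi.single p 1 ⊠ Pi.single q 1) +
      (γ / s + x γ lam q p) • (Pi.single q 1 ⊠ Pi.single p 1) := by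
  simp only [D, Dinf, sum_erase_x_smul, Matrix.add_mulVec, Matrix.one_mulVec, Matrix.sum_mulVec,
    Matrix.smul_mulVec, Matrix.sub_mulVec, e_kronecker_e_mulVec, dMat_mulVec, smul_sub, smul_ite,
    smul_zero, Finset.sum_sub_distrib, Finset.sum_ite_irrel, Finset.sum_ite_eq',
    Finset.sum_const_zero, Finset.mem_univ, if_true]
  module

end Operators

/-! ### Sums over interpolation nodes -/

section Interpolation

variable {F ι : Type*} [Field F] [DecidableEq ι] {s : Finset ι} {v : ι → F} {P Q : F[X]}

theorem sum_nodalWeight_mul_eval_of_degree_lt (hv : Set.InjOn v s) (hP : P.degree < s.card) :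
    ∑ j ∈ s, Lagrange.nodalWeight s v j * P.eval (v j) = P.coeff (s.card - 1) := by
  simp only [Lagrange.coeff_eq_sum hv hP, Lagrange.nodalWeight, Finset.prod_inv_distrib,
    div_eq_inv_mul]

omit [DecidableEq ι] in
theorem degree_sub_coeff_mul_nodal_lt (hP : P.degree ≤ s.card) :
    (P - Polynomial.C (P.coeff s.card) * Lagrange.nodal s v).degree < s.card := by
  rw [Polynomial.degree_lt_iff_coeff_zero]
  intro m hm
  rw [Polynomial.coeff_sub, Polynomial.coeff_C_mul]
  rcases hm.eq_or_lt with rfl | hlt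
  · have hlead := (Lagrange.nodal_monic (s := s) (v := v)).coeff_natDegree
    rw [Lagrange.natDegree_nodal] at hlead
    rw [hlead, mul_one, sub_self]
  · rw [Polynomial.coeff_eq_zero_of_degree_lt (hP.trans_lt (by exact_mod_cast hlt)),
      Polynomial.coeff_eq_zero_of_degree_lt (p := Lagrange.nodal s v)
        (by rw [Lagrange.degree_nodal]; exact_mod_cast hlt), mul_zero, sub_zero]

omit [DecidableEq ι] in
theorem eval_sub_coeff_mul_nodal_of_mem {j : ι} (hj : j ∈ s) :
    (P - Polynomial.C (P.coeff s.card) * Lagrange.nodal s v).eval (v j) = P.eval (v j) := by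
  rw [Polynomial.eval_sub, Polynomial.eval_mul, Lagrange.eval_nodal_at_node hj, mul_zero, sub_zero]

theorem sum_nodalWeight_mul_eval (hs : s.Nonempty) (hv : Set.InjOn v s)
    (hP : P.degree ≤ s.card) :
    ∑ j ∈ s, Lagrange.nodalWeight s v j * P.eval (v j) =
      P.coeff (s.card - 1) + P.coeff s.card * ∑ j ∈ s, v j := by
  have h := sum_nodalWeight_mul_eval_of_degree_lt hv (degree_sub_coeff_mul_nodal_lt (v := v) hP)
  rw [Polynomial.coeff_sub, Polynomial.coeff_C_mul, Lagrange.nodal_eq,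
    Polynomial.prod_X_sub_C_coeff_card_pred s v hs.card_pos, ← Lagrange.nodal_eq, mul_neg,
    sub_neg_eq_add] at h
  rw [← h]
  exact Finset.sum_congr rfl fun j hj => by rw [eval_sub_coeff_mul_nodal_of_mem hj]

theorem eval_nodal_mul_sum_nodalWeight_mul_eval_div (hv : Set.InjOn v s)
    (hP : P.degree ≤ s.card) {z : F} (hz : ∀ j ∈ s, z ≠ v j) :
    (Lagrange.nodal s v).eval z * ∑ j ∈ s, Lagrange.nodalWeight s v j * (P.eval (v j) / (z - v j)) =
      P.eval z - P.coeff s.card * (Lagrange.nodal s v).eval z := by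
  have h := congrArg (Polynomial.eval z)
    (Lagrange.eq_interpolate hv (degree_sub_coeff_mul_nodal_lt (v := v) hP))
  rw [Lagrange.eval_interpolate_not_at_node _ hz, Polynomial.eval_sub, Polynomial.eval_C_mul] at h
  rw [h]
  congr 1
  exact Finset.sum_congr rfl fun j hj => by
    rw [eval_sub_coeff_mul_nodal_of_mem hj, div_eq_inv_mul, mul_assoc]

theorem nodalWeight_mul_derivative_add_sum_erase (hv : Set.InjOn v s) (hP : P.degree ≤ s.card)
    {i : ι} (hi : i ∈ s) (hPi : P.eval (v i) = 0) :
    Lagrange.nodalWeight s v i * P.derivative.eval (v i) +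
      ∑ j ∈ s.erase i, Lagrange.nodalWeight s v j * (P.eval (v j) / (v j - v i)) =
      P.coeff s.card := by
  obtain ⟨S, rfl⟩ := Polynomial.dvd_iff_isRoot.2 hPi
  have hS : S.degree < s.card := by
    rw [Polynomial.degree_mul, Polynomial.degree_X_sub_C] at hP
    by_contra! h
    have := (add_le_add_right h 1).trans hP
    norm_cast at this
    omega
  have hcoeff : ((Polynomial.X - Polynomial.C (v i)) * S).coeff s.card = S.coeff (s.card - 1) := by
    obtain ⟨m, hm⟩ := Nat.exists_eq_succ_of_ne_zero (Finset.card_ne_zero_of_mem hi)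
    rw [hm] at hS ⊢
    rw [sub_mul, Polynomial.coeff_sub, Polynomial.coeff_X_mul, Polynomial.coeff_C_mul,
      Polynomial.coeff_eq_zero_of_degree_lt hS, mul_zero, sub_zero, Nat.succ_sub_one]
  rw [hcoeff, ← sum_nodalWeight_mul_eval_of_degree_lt hv hS, ← Finset.add_sum_erase s _ hi]
  congr 1
  · simp only [Polynomial.derivative_mul, Polynomial.derivative_X_sub_C, Polynomial.eval_add,
      Polynomial.eval_mul, Polynomial.eval_sub, Polynomial.eval_X, Polynomial.eval_C, sub_self,
      zero_mul, add_zero, one_mul]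
  · refine Finset.sum_congr rfl fun j hj => ?_
    obtain ⟨hne, hjs⟩ := Finset.mem_erase.1 hj
    have hsub : v j - v i ≠ 0 := sub_ne_zero.2 fun h => hne (hv hjs hi h)
    rw [Polynomial.eval_mul, Polynomial.eval_sub, Polynomial.eval_X, Polynomial.eval_C,
      mul_div_cancel_left₀ _ hsub]

/-- The Lagrange sum, at the node `v i`, of the Bezoutian
`(P(X) Q(Y) - P(Y) Q(X)) / (X - Y)` with its diagonal value `P' Q - P Q'`. -/
theorem nodalWeight_mul_wronskian_add_sum_erase (hv : Set.InjOn v s) (hP : P.degree ≤ s.card)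
    (hQ : Q.degree ≤ s.card) {i : ι} (hi : i ∈ s) :
    Lagrange.nodalWeight s v i * (Q.eval (v i) * P.derivative.eval (v i) -
        P.eval (v i) * Q.derivative.eval (v i)) +
      ∑ j ∈ s.erase i, Lagrange.nodalWeight s v j *
        ((Q.eval (v i) * P.eval (v j) - P.eval (v i) * Q.eval (v j)) / (v j - v i)) =
      Q.eval (v i) * P.coeff s.card - P.eval (v i) * Q.coeff s.card := by
  have hdeg : (Q.eval (v i) • P - P.eval (v i) • Q).degree ≤ s.card :=
    (Polynomial.degree_sub_le_of_le ((Polynomial.degree_smul_le _ _).trans hP)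
      ((Polynomial.degree_smul_le _ _).trans hQ)).trans_eq (max_self _)
  simpa only [Polynomial.eval_sub, Polynomial.eval_smul, Polynomial.derivative_sub,
    Polynomial.derivative_smul, Polynomial.coeff_sub, Polynomial.coeff_smul, smul_eq_mul] using
    nodalWeight_mul_derivative_add_sum_erase hv hdeg hi
      (by simp only [Polynomial.eval_sub, Polynomial.eval_smul, smul_eq_mul, mul_comm, sub_self])

end Interpolation

/-! ### Entries of `R` -/

section Entries

variable {n : ℕ}

theorem E_kronecker_E_apply (i j k l : ℕ) (a b c d : Fin n) :
    (E n i j ⊗ₖ E n k l) (a, b) (c, d) =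
      if (a : ℕ) + 1 = i then if (b : ℕ) + 1 = k then
        if (c : ℕ) + 1 = j then if (d : ℕ) + 1 = l then 1 else 0 else 0 else 0 else 0 := by
  simp only [Matrix.kroneckerMap_apply, E, Matrix.of_apply, ← ite_and, mul_ite, mul_one, mul_zero]
  exact if_congr (by tauto) rfl rfl

theorem E_kronecker_E_apply_swap (i j k l : ℕ) (a b c d : Fin n) :
    (E n i j ⊗ₖ E n k l) (a, b) (c, d) = (E n k l ⊗ₖ E n i j) (b, a) (d, c) :=
  mul_comm _ _

/-- The coefficient of `X ^ c * Y ^ d` in `(X ^ a * Y ^ b - X ^ b * Y ^ a) / (X - Y)` when `b < a`,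
and zero when `a ≤ b`. -/
def divDiffCoeff (a b c d : ℕ) : ℂ := if b ≤ c ∧ c < a ∧ c + d + 1 = a + b then 1 else 0

theorem sum_indicator_eq {ι : Type*} (s : Finset ι) (i₀ : ι) (P : ι → Prop) [DecidablePred P]
    {Q : Prop} [Decidable Q] (h : ∀ i ∈ s, P i → i = i₀ ∧ Q) (h' : Q → i₀ ∈ s ∧ P i₀) :
    ∑ i ∈ s, (if P i then (1 : ℂ) else 0) = if Q then 1 else 0 := by
  split_ifs with hQ
  · rw [Finset.sum_eq_single_of_mem i₀ (h' hQ).1 fun i hi hne => if_neg fun hP =>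
      hne (h i hi hP).1, if_pos (h' hQ).2]
  · exact Finset.sum_eq_zero fun i hi => if_neg fun hP => hQ (h i hi hP).2

theorem divDiffCoeff_of_le_left {a b : ℕ} (c d : ℕ) (h : a ≤ b) : divDiffCoeff a b c d = 0 :=
  if_neg (by omega)

theorem divDiffCoeff_of_le_middle {a c : ℕ} (b d : ℕ) (h : a ≤ c) : divDiffCoeff a b c d = 0 :=
  if_neg (by omega)

theorem divDiffCoeff_of_le_right {a d : ℕ} (b c : ℕ) (h : a ≤ d) : divDiffCoeff a b c d = 0 :=
  if_neg (by omega)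

variable (i : ℕ) (a b c d : Fin n)

theorem sum_E_row_apply :
    ∑ k ∈ Finset.Icc 1 (i - 1), ∑ j ∈ Finset.Icc 1 (i - k),
        (E n i (i - k) ⊗ₖ E n j (j + k - 1)) (a, b) (c, d) =
      if (a : ℕ) + 1 = i then divDiffCoeff a b c d else 0 := by
  simp only [E_kronecker_E_apply, divDiffCoeff, ← ite_and, Finset.sum_sigma']
  apply sum_indicator_eq _ ⟨i - 1 - c, b + 1⟩
  · rintro ⟨k, j⟩
    simp only [Finset.mem_sigma, Finset.mem_Icc, Sigma.mk.injEq, heq_eq_eq]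
    omega
  · simp only [Finset.mem_sigma, Finset.mem_Icc, true_and]
    omega

theorem sum_E_row_succ_apply :
    ∑ k ∈ Finset.Icc 1 (n - 1), ∑ j ∈ Finset.Icc 1 (n - 1 - k),
        (E n n (n - k) ⊗ₖ E n j (j + k)) (a, b) (c, d) =
      if (a : ℕ) + 1 = n then divDiffCoeff a (b + 1) c d else 0 := by
  simp only [E_kronecker_E_apply, divDiffCoeff, ← ite_and, Finset.sum_sigma']
  apply sum_indicator_eq _ ⟨n - 1 - c, b + 1⟩
  · rintro ⟨k, j⟩
    simp only [Finset.mem_sigma, Finset.mem_Icc, Sigma.mk.injEq, heq_eq_eq]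
    omega
  · simp only [Finset.mem_sigma, Finset.mem_Icc, true_and]
    omega

theorem sum_E_row_apply' :
    ∑ k ∈ Finset.Icc 1 (i - 1), ∑ j ∈ Finset.Icc 1 (i - k),
        (E n j (j + k - 1) ⊗ₖ E n i (i - k)) (a, b) (c, d) =
      if (b : ℕ) + 1 = i then divDiffCoeff b a d c else 0 := by
  simp only [← sum_E_row_apply i b a d c, E_kronecker_E_apply_swap _ _ i]

theorem sum_E_row_succ_apply' :
    ∑ k ∈ Finset.Icc 1 (n - 1), ∑ j ∈ Finset.Icc 1 (n - 1 - k),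
        (E n j (j + k) ⊗ₖ E n n (n - k)) (a, b) (c, d) =
      if (b : ℕ) + 1 = n then divDiffCoeff b (a + 1) d c else 0 := by
  simp only [← sum_E_row_succ_apply b a d c, E_kronecker_E_apply_swap _ _ n]

end Entries

/-! ### The polynomial gauge -/

section PolynomialGauge

variable {n : ℕ}

/-- The diagonal matrix `diag(1, …, 1, κ)`. -/
def gauge (n : ℕ) (κ : ℂ) : Mat n :=
  Matrix.diagonal fun i => if (i : ℕ) + 1 = n then κ else 1

/-- The matrix `R` in a gauge that makes its entries polynomials in `p = σ + u + γ` and `q = σ + v`,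
up to the permutation term. The constant `f₀` of the statement only enters through the gauge. -/
def polyR (n : ℕ) (γ s p q : ℂ) : Mat2 n := Matrix.of fun i j =>
  (if j = i then 1 else 0) + (if j = i.swap then s else 0) +
    γ * (if (i.1 : ℕ) + 1 = n then
      if (i.2 : ℕ) + 1 = n then 0
      else p * divDiffCoeff i.1 i.2 j.1 j.2 - divDiffCoeff i.1 (i.2 + 1) j.1 j.2
    else
      if (i.2 : ℕ) + 1 = n then
        divDiffCoeff i.2 (i.1 + 1) j.2 j.1 - q * divDiffCoeff i.2 i.1 j.2 j.1
      else divDiffCoeff i.1 i.2 j.1 j.2 - divDiffCoeff i.2 i.1 j.2 j.1)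

theorem R_eq_gauge_mul_polyR_mul_gauge (γ f0 u v : ℂ) (lam : Fin n → ℂ) :
    R γ f0 u v lam =
      (gauge n (sigma lam + u + f0)⁻¹ ⊗ₖ gauge n (sigma lam + v - γ + f0)⁻¹) *
        polyR n γ (γ / (u - v)) (sigma lam + u + γ) (sigma lam + v) *
        (gauge n (sigma lam + u - γ + f0) ⊗ₖ gauge n (sigma lam + v + f0)) := by
  ext ⟨a, b⟩ ⟨c, d⟩
  obtain _ | m := n
  · exact a.elim0
  simp only [gauge, Matrix.diagonal_kronecker_diagonal, Matrix.mul_diagonal, Matrix.diagonal_mul]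
  simp only [R, polyR, Matrix.add_apply, Matrix.sub_apply, Matrix.smul_apply, smul_eq_mul,
    Matrix.sum_apply, Matrix.of_apply, Finset.sum_sub_distrib, sum_E_row_apply, sum_E_row_apply',
    sum_E_row_succ_apply, sum_E_row_succ_apply']
  generalize γ / (u - v) = s
  generalize sigma lam + u + f0 = U at *
  generalize sigma lam + v - γ + f0 = W at *
  simp only [E_kronecker_E_apply, Finset.sum_ite_irrel, Finset.sum_ite_eq, Finset.sum_const_zero,
    Finset.mem_Icc, Finset.mem_erase]
  have hle (k : Fin m) : (k : ℕ) ≤ m := k.isLt.le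
  have hne (k : Fin m) : (k : ℕ) ≠ m := k.isLt.ne
  have hlast (k : Fin m) : Fin.last m ≠ k.castSucc := (Fin.castSucc_ne_last k).symm
  induction a using Fin.lastCases <;> induction b using Fin.lastCases <;>
    induction c using Fin.lastCases <;> induction d using Fin.lastCases
  all_goals
    simp only [Prod.swap, Prod.mk.injEq, Fin.val_last, Fin.val_castSucc, Fin.ext_iff, hne,
      (hne _).symm, hlast, divDiffCoeff_of_le_left, divDiffCoeff_of_le_middle,
      divDiffCoeff_of_le_right, hle, le_refl, Nat.le_succ, add_left_inj, Nat.succ_le_iff,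
      Nat.lt_irrefl, Nat.add_sub_cancel, Nat.succ_pos, ite_self, if_true, if_false, Fin.is_lt,
      true_and, and_true, false_and, and_false, ne_eq, not_true, not_false_eq_true, mul_zero,
      mul_one, zero_mul, one_mul, add_zero, zero_add, sub_zero, zero_sub, sub_self]
  case last.last.last.last => ring
  case cast.cast.cast.cast => split_ifs <;> first | ring1 | grind
  all_goals (try split_ifs) <;> ring

/-- The polynomials `1, z, …, z ^ (n - 2), z ^ (n - 1) * (p - z)`, whose values at `λ_j` are, up to
a normalization, the `j`-th column of the twist. -/
def twistPoly (p : ℂ) (i : Fin n) : ℂ[X] :=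
  if (i : ℕ) + 1 = n then Polynomial.X ^ (i : ℕ) * (Polynomial.C p - Polynomial.X)
  else Polynomial.X ^ (i : ℕ)

/-- The values at `z` of the polynomials `twistPoly p`. -/
def twistVec (p z : ℂ) (i : Fin n) : ℂ := (twistPoly p i).eval z

theorem twistVec_apply (p z : ℂ) (i : Fin n) :
    twistVec p z i = if (i : ℕ) + 1 = n then z ^ (i : ℕ) * (p - z) else z ^ (i : ℕ) := by
  rw [twistVec, twistPoly]
  split_ifs <;> simp only [Polynomial.eval_mul, Polynomial.eval_sub, Polynomial.eval_pow,
    Polynomial.eval_X, Polynomial.eval_C]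

theorem sum_divDiffCoeff_mul_right {a b : ℕ} (ha : a < n) (q Y : ℂ) (c : Fin n) :
    ∑ d : Fin n, divDiffCoeff a b c d * twistVec q Y d =
      if (c : ℕ) ∈ Finset.Ico b a then Y ^ (a + b - 1 - c) else 0 := by
  simp only [Finset.mem_Ico]
  split_ifs with h
  · rw [Finset.sum_eq_single_of_mem (⟨a + b - 1 - c, by omega⟩ : Fin n) (Finset.mem_univ _)]
    · rw [divDiffCoeff, if_pos (by simp only; omega), one_mul, twistVec_apply,
        if_neg (by simp only; omega)]
    · intro d _ hd
      rw [divDiffCoeff, if_neg (by grind), zero_mul]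
  · exact Finset.sum_eq_zero fun d _ => by rw [divDiffCoeff, if_neg (by omega), zero_mul]

theorem sub_mul_sum_divDiffCoeff_mul {a b : ℕ} (hb : b ≤ a) (ha : a < n) (p q X Y : ℂ) :
    (X - Y) * ∑ t : Fin n × Fin n,
      divDiffCoeff a b t.1 t.2 * (twistVec p X t.1 * twistVec q Y t.2) =
        X ^ a * Y ^ b - X ^ b * Y ^ a := by
  have hrow (c : Fin n) : ∑ d : Fin n, divDiffCoeff a b c d * (twistVec p X c * twistVec q Y d) =
      if (c : ℕ) ∈ Finset.Ico b a then X ^ (c : ℕ) * Y ^ (a - 1 - c) * Y ^ b else 0 := by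
    simp only [mul_left_comm (divDiffCoeff _ _ _ _)]
    rw [← Finset.mul_sum, sum_divDiffCoeff_mul_right ha, mul_ite, mul_zero]
    refine if_ctx_congr Iff.rfl (fun h => ?_) fun _ => rfl
    rw [Finset.mem_Ico] at h
    rw [twistVec_apply, if_neg (by omega), mul_assoc, ← pow_add,
      show a - 1 - (c : ℕ) + b = a + b - 1 - c by omega]
  have hfilter : (Finset.range n).filter (· ∈ Finset.Ico b a) = Finset.Ico b a := by
    grind
  simp only [Fintype.sum_prod_type, hrow]
  rw [Fin.sum_univ_eq_sum_range
      fun c => if c ∈ Finset.Ico b a then X ^ c * Y ^ (a - 1 - c) * Y ^ b else 0,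
    ← Finset.sum_filter, hfilter, ← Finset.sum_mul, ← mul_assoc,
    (Commute.all X Y).mul_geom_sum₂_Ico hb]
  obtain ⟨k, rfl⟩ := Nat.exists_eq_add_of_le hb
  rw [Nat.add_sub_cancel_left]
  ring

theorem sub_mul_sum_divDiffCoeff_mul_swap {a b : ℕ} (hb : b ≤ a) (ha : a < n) (p q X Y : ℂ) :
    (X - Y) * ∑ t : Fin n × Fin n,
      divDiffCoeff a b t.2 t.1 * (twistVec p X t.1 * twistVec q Y t.2) =
        X ^ a * Y ^ b - X ^ b * Y ^ a := by
  rw [← (Equiv.prodComm (Fin n) (Fin n)).sum_comp]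
  simp only [Equiv.prodComm_apply, Prod.fst_swap, Prod.snd_swap, mul_comm (twistVec p X _)]
  linear_combination -sub_mul_sum_divDiffCoeff_mul hb ha q p Y X

theorem sub_smul_polyR_mulVec {γ s p q : ℂ} (hs : s * (p - q - γ) = γ) (X Y : ℂ) :
    (X - Y) • (polyR n γ s p q *ᵥ (twistVec (p - γ) X ⊠ twistVec (q + γ) Y)) =
      (X - Y + γ) • (twistVec p X ⊠ twistVec q Y) +
        (s * (X - Y) - γ) • (twistVec p Y ⊠ twistVec q X) := by
  ext ⟨a, b⟩
  have ha := a.isLt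
  have hb := b.isLt
  have h {i j : ℕ} :=
    @sub_mul_sum_divDiffCoeff_mul n i j (p := p - γ) (q := q + γ) (X := X) (Y := Y)
  have h' {i j : ℕ} :=
    @sub_mul_sum_divDiffCoeff_mul_swap n i j (p := p - γ) (q := q + γ) (X := X) (Y := Y)
  simp only [Pi.smul_apply, Pi.add_apply, smul_eq_mul, Matrix.mulVec, dotProduct, polyR,
    Matrix.of_apply, tmul_apply, add_mul, Finset.sum_add_distrib, ite_mul, one_mul, zero_mul,
    Finset.sum_ite_eq', Finset.mem_univ, if_true, mul_assoc, ← Finset.mul_sum, Prod.fst_swap,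
    Prod.snd_swap]
  split_ifs with ha' hb' hb'
  · obtain rfl : a = b := Fin.ext (by omega)
    simp only [Finset.sum_const_zero, twistVec_apply, if_pos ha']
    linear_combination ((X - Y) * X ^ (a : ℕ) * Y ^ (a : ℕ) * (γ - Y + X)) * hs
  · have h₁ := h (show (b : ℕ) ≤ a by omega) ha
    have h₂ := h (show (b : ℕ) + 1 ≤ a by omega) ha
    simp only [sub_mul, mul_assoc, Finset.sum_sub_distrib, ← Finset.mul_sum]
    simp only [twistVec_apply, if_pos ha', if_neg hb'] at h₁ h₂ ⊢
    linear_combination γ * p * h₁ - γ * h₂ - (X - Y) * X ^ (b : ℕ) * Y ^ (a : ℕ) * hs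
  · have h₁ := h' (show (a : ℕ) ≤ b by omega) hb
    have h₂ := h' (show (a : ℕ) + 1 ≤ b by omega) hb
    simp only [sub_mul, mul_assoc, Finset.sum_sub_distrib, ← Finset.mul_sum]
    simp only [twistVec_apply, if_pos hb', if_neg ha'] at h₁ h₂ ⊢
    linear_combination γ * h₂ - γ * q * h₁ + (X - Y) * X ^ (b : ℕ) * Y ^ (a : ℕ) * hs
  · simp only [sub_mul, Finset.sum_sub_distrib]
    rcases le_total (a : ℕ) b with hab | hab
    · have h₁ := h' hab hb
      simp only [divDiffCoeff_of_le_left _ _ hab, zero_mul, Finset.sum_const_zero]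
      simp only [twistVec_apply, if_neg ha', if_neg hb'] at h₁ ⊢
      linear_combination -γ * h₁
    · have h₁ := h hab ha
      simp only [divDiffCoeff_of_le_left _ _ hab, zero_mul, Finset.sum_const_zero]
      simp only [twistVec_apply, if_neg ha', if_neg hb'] at h₁ ⊢
      linear_combination γ * h₁

theorem polyR_mulVec_of_ne {γ s p q : ℂ} (hs : s * (p - q - γ) = γ) {X Y : ℂ} (h : X ≠ Y) :
    polyR n γ s p q *ᵥ (twistVec (p - γ) X ⊠ twistVec (q + γ) Y) =
      (1 + γ / (X - Y)) • (twistVec p X ⊠ twistVec q Y) +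
        (s - γ / (X - Y)) • (twistVec p Y ⊠ twistVec q X) := by
  have hXY : X - Y ≠ 0 := sub_ne_zero.2 h
  refine smul_right_injective _ hXY ?_
  simp only [sub_smul_polyR_mulVec hs, smul_add, smul_smul]
  congr 2 <;> field_simp

theorem eval_eq_eval_derivative_of_sub_mul_eval {F : Type*} [Field F] [Infinite F] {P Q : F[X]}
    {z : F} (h : ∀ w, (w - z) * P.eval w = Q.eval w) : P.eval z = Q.derivative.eval z := by
  have hPQ : (Polynomial.X - Polynomial.C z) * P = Q :=
    Polynomial.funext fun w => by simpa using h w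
  simp [← hPQ]

/-- The vector of derivatives at `z` of the polynomials `twistPoly p`. -/
def twistVecDeriv (p z : ℂ) (i : Fin n) : ℂ := (twistPoly p i).derivative.eval z

theorem polyR_mulVec_self {γ s p q : ℂ} (hs : s * (p - q - γ) = γ) (z : ℂ) :
    polyR n γ s p q *ᵥ (twistVec (p - γ) z ⊠ twistVec (q + γ) z) =
      (1 + s) • (twistVec p z ⊠ twistVec q z) +
        γ • (twistVecDeriv p z ⊠ twistVec q z - twistVec p z ⊠ twistVecDeriv q z) := by
  -- Let `w → z` in the action on the labels `w` and `z`, which is a polynomial identity in `w`.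
  ext t
  let P : ℂ[X] := ∑ j : Fin n × Fin n,
    Polynomial.C (polyR n γ s p q t j * twistVec (q + γ) z j.2) * twistPoly (p - γ) j.1
  let Q : ℂ[X] := (Polynomial.X - Polynomial.C (z - γ)) *
      (twistPoly p t.1 * Polynomial.C (twistVec q z t.2)) +
    (Polynomial.C s * Polynomial.X - Polynomial.C (s * z + γ)) *
      (Polynomial.C (twistVec p z t.1) * twistPoly q t.2)
  have hP (w : ℂ) :
      P.eval w = (polyR n γ s p q *ᵥ (twistVec (p - γ) w ⊠ twistVec (q + γ) z)) t := by
    simp only [P, Polynomial.eval_finsetSum, Polynomial.eval_mul, Polynomial.eval_C,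
      Matrix.mulVec, dotProduct, tmul_apply, twistVec, mul_assoc, mul_comm (Polynomial.eval w _)]
  rw [← hP, eval_eq_eval_derivative_of_sub_mul_eval (Q := Q) fun w => ?_]
  · simp only [map_sub, twistVec, map_add, map_mul, Polynomial.derivative_mul,
      Polynomial.derivative_X, Polynomial.derivative_C, sub_self, sub_zero, one_mul, mul_zero,
      add_zero, zero_mul, mul_one, zero_add, Polynomial.eval_add, Polynomial.eval_mul,
      Polynomial.eval_C, Polynomial.eval_sub, Polynomial.eval_X, sub_sub_cancel,
      sub_add_cancel_left, neg_mul, Pi.add_apply, Pi.smul_apply, tmul_apply, smul_eq_mul,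
      Pi.sub_apply, twistVecDeriv, Q]
    ring
  · rw [hP]
    have h := congrFun (sub_smul_polyR_mulVec hs w z) t
    simp only [Pi.smul_apply, smul_eq_mul, Pi.add_apply, tmul_apply, twistVec, map_sub, map_add,
      map_mul, Polynomial.eval_add, Polynomial.eval_mul, Polynomial.eval_sub, Polynomial.eval_X,
      Polynomial.eval_C, Q] at h ⊢
    rw [h]
    ring

end PolynomialGauge

/-! ### The twist -/

section Twist

variable {n : ℕ}

theorem isUnit_gauge {κ : ℂ} (hκ : κ ≠ 0) : IsUnit (gauge n κ) := by
  rw [gauge, Matrix.isUnit_diagonal, Pi.isUnit_iff]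
  intro i
  split_ifs
  exacts [hκ.isUnit, isUnit_one]

theorem gauge_mul_gauge (κ μ : ℂ) : gauge n κ * gauge n μ = gauge n (κ * μ) := by
  rw [gauge, gauge, gauge, Matrix.diagonal_mul_diagonal]
  congr 1
  ext i
  split_ifs
  exacts [rfl, one_mul 1]

theorem gauge_one : gauge n 1 = 1 := by
  simp only [gauge, ite_self, Matrix.diagonal_one]

theorem gauge_mul_gauge_inv {κ : ℂ} (hκ : κ ≠ 0) : gauge n κ * gauge n κ⁻¹ = 1 := by
  rw [gauge_mul_gauge, mul_inv_cancel₀ hκ, gauge_one]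

/-- The last vector of the standard basis. -/
def lastVec (n : ℕ) (i : Fin n) : ℂ := if (i : ℕ) + 1 = n then 1 else 0

theorem degree_twistPoly_le (p : ℂ) (i : Fin n) :
    (twistPoly p i).degree ≤ (Finset.univ : Finset (Fin n)).card := by
  have hi := i.isLt
  rw [Finset.card_fin, Polynomial.degree_le_iff_coeff_zero]
  intro m hm
  rw [Nat.cast_lt] at hm
  rw [twistPoly]
  split_ifs
  · rw [Polynomial.coeff_X_pow_mul', if_pos (by omega), Polynomial.coeff_sub, Polynomial.coeff_C,
      Polynomial.coeff_X, if_neg (by omega), if_neg (by omega), sub_zero]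
  · rw [Polynomial.coeff_X_pow, if_neg (by omega)]

theorem coeff_twistPoly_self (p : ℂ) (i : Fin n) : (twistPoly p i).coeff n = -lastVec n i := by
  have hi := i.isLt
  rw [twistPoly, lastVec]
  split_ifs
  · rw [Polynomial.coeff_X_pow_mul', if_pos (by omega), Polynomial.coeff_sub, Polynomial.coeff_C,
      Polynomial.coeff_X, if_neg (by omega), if_pos (by omega), zero_sub]
  · rw [Polynomial.coeff_X_pow, if_neg (by omega), neg_zero]

theorem coeff_twistPoly_pred (p : ℂ) (i : Fin n) :
    (twistPoly p i).coeff (n - 1) = p * lastVec n i := by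
  have hi := i.isLt
  rw [twistPoly, lastVec]
  split_ifs
  · rw [Polynomial.coeff_X_pow_mul', if_pos (by omega), Polynomial.coeff_sub, Polynomial.coeff_C,
      Polynomial.coeff_X, if_pos (by omega), if_neg (by omega), sub_zero, mul_one]
  · rw [Polynomial.coeff_X_pow, if_neg (by omega), mul_zero]

variable {lam : Fin n → ℂ}

theorem sum_nodalWeight_smul_twistVec (h : Function.Injective lam) (p : ℂ) :
    ∑ j, Lagrange.nodalWeight Finset.univ lam j • twistVec p (lam j) =
      (p - sigma lam) • lastVec n := by
  ext i
  have hsum := sum_nodalWeight_mul_eval ⟨i, Finset.mem_univ i⟩ h.injOn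
    (degree_twistPoly_le p i)
  rw [Finset.card_fin, coeff_twistPoly_self, coeff_twistPoly_pred] at hsum
  simp only [Finset.sum_apply, Pi.smul_apply, smul_eq_mul, twistVec, sigma]
  linear_combination hsum

theorem sum_nodalWeight_div_smul_twistVec (h : Function.Injective lam) (p : ℂ) {z : ℂ}
    (hz : ∀ j, z ≠ lam j) :
    ∑ j, (Lagrange.nodalWeight Finset.univ lam j / (z - lam j)) • twistVec p (lam j) =
      ((Lagrange.nodal Finset.univ lam).eval z)⁻¹ • twistVec p z + lastVec n := by
  ext i
  have hnodal : (Lagrange.nodal Finset.univ lam).eval z ≠ 0 :=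
    Lagrange.eval_nodal_not_at_node fun j _ => hz j
  have hsum := eval_nodal_mul_sum_nodalWeight_mul_eval_div h.injOn
    (degree_twistPoly_le p i) fun j _ => hz j
  rw [Finset.card_fin, coeff_twistPoly_self] at hsum
  simp only [Finset.sum_apply, Pi.smul_apply, Pi.add_apply, smul_eq_mul, twistVec,
    div_mul_eq_mul_div, mul_div_assoc]
  rw [eq_comm, inv_mul_eq_div, div_add' _ _ _ hnodal, div_eq_iff hnodal]
  linear_combination -hsum

theorem smul_tmul_lastVec_sub (h : Function.Injective lam) (γ p q : ℂ) (i : Fin n) :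
    γ • (twistVec p (lam i) ⊠ lastVec n - lastVec n ⊠ twistVec q (lam i)) =
      (γ * Lagrange.nodalWeight Finset.univ lam i) •
        (twistVecDeriv p (lam i) ⊠ twistVec q (lam i) -
          twistVec p (lam i) ⊠ twistVecDeriv q (lam i)) +
      ∑ j, (x γ lam j i * Lagrange.nodalWeight Finset.univ lam j) •
        (twistVec p (lam j) ⊠ twistVec q (lam i) - twistVec p (lam i) ⊠ twistVec q (lam j)) := by
  ext ⟨a, b⟩
  have hsum := nodalWeight_mul_wronskian_add_sum_erase h.injOn (degree_twistPoly_le p a)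
    (degree_twistPoly_le q b) (Finset.mem_univ i)
  rw [Finset.card_fin, coeff_twistPoly_self, coeff_twistPoly_self, Finset.sum_erase _
    (by rw [sub_self, div_zero, mul_zero])] at hsum
  simp only [Pi.smul_apply, Pi.sub_apply, Pi.add_apply, Finset.sum_apply, tmul_apply, smul_eq_mul,
    twistVecDeriv, twistVec, x]
  have hterm (j : Fin n) (w s t : ℂ) :
      γ / (lam j - lam i) * w * (s - t) = γ * (w * ((s - t) / (lam j - lam i))) := by ring
  simp only [hterm, ← Finset.mul_sum]
  simp only [mul_comm (Polynomial.eval _ (twistPoly q b))] at hsum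
  linear_combination -γ * hsum

/-- The twist in the gauge of `polyR`: its columns are the vectors `twistVec p (λ_j)`, weighted as
in Lagrange interpolation at the `λ_j`. -/
def polyTwist (p : ℂ) (lam : Fin n → ℂ) : Mat n :=
  Matrix.of fun i j => Lagrange.nodalWeight Finset.univ lam j * twistVec p (lam j) i

theorem polyTwist_mulVec (p : ℂ) (lam c : Fin n → ℂ) :
    polyTwist p lam *ᵥ c =
      ∑ j, (c j * Lagrange.nodalWeight Finset.univ lam j) • twistVec p (lam j) := by
  ext i
  simp only [polyTwist, Matrix.mulVec, dotProduct, Matrix.of_apply, Finset.sum_apply,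
    Pi.smul_apply, smul_eq_mul]
  exact Finset.sum_congr rfl fun j _ => by ring

theorem polyTwist_mulVec_single (p : ℂ) (lam : Fin n → ℂ) (j : Fin n) :
    polyTwist p lam *ᵥ Pi.single j 1 =
      Lagrange.nodalWeight Finset.univ lam j • twistVec p (lam j) :=
  Matrix.mulVec_single_one _ _

theorem polyTwist_mulVec_one (h : Function.Injective lam) (p : ℂ) :
    polyTwist p lam *ᵥ 1 = (p - sigma lam) • lastVec n := by
  simp only [polyTwist_mulVec, Pi.one_apply, one_mul, sum_nodalWeight_smul_twistVec h]

theorem eq_zero_of_dotProduct_twistVec (h : Function.Injective lam) {p : ℂ} {r : Fin n → ℂ}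
    (hlast : r ⬝ᵥ lastVec n = 0) (hnode : ∀ j, r ⬝ᵥ twistVec p (lam j) = 0) : r = 0 := by
  have hr (i : Fin n) (hi : (i : ℕ) + 1 = n) : r i = 0 := by
    rw [← hlast, dotProduct, Finset.sum_eq_single_of_mem i (Finset.mem_univ i), lastVec, if_pos hi,
      mul_one]
    intro k _ hk
    rw [lastVec, if_neg fun hk' => hk (Fin.ext (by omega)), mul_zero]
  refine Matrix.eq_zero_of_mulVec_eq_zero (Matrix.det_vandermonde_ne_zero_iff.2 h) ?_
  ext j
  rw [Pi.zero_apply, ← hnode j, Matrix.mulVec, dotProduct_comm]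
  refine Finset.sum_congr rfl fun i _ => ?_
  by_cases hi : (i : ℕ) + 1 = n
  · rw [hr i hi, zero_mul, zero_mul]
  · simp only [twistVec_apply, if_neg hi, Matrix.vandermonde_apply]

theorem isUnit_polyTwist (h : Function.Injective lam) {p : ℂ} (hp : p ≠ sigma lam) :
    IsUnit (polyTwist p lam) := by
  rw [← Matrix.vecMul_injective_iff_isUnit, ← Matrix.coe_vecMulLinear, ← LinearMap.ker_eq_bot,
    LinearMap.ker_eq_bot']
  intro r hr
  rw [Matrix.vecMulLinear_apply] at hr
  refine eq_zero_of_dotProduct_twistVec h (p := p) ?_ fun j => ?_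
  · refine (mul_eq_zero.1 (?_ : (p - sigma lam) * _ = 0)).resolve_left (sub_ne_zero.2 hp)
    rw [← smul_eq_mul, ← dotProduct_smul, ← polyTwist_mulVec_one h, Matrix.dotProduct_mulVec, hr,
      zero_dotProduct]
  · refine (mul_eq_zero.1 (?_ : Lagrange.nodalWeight Finset.univ lam j * _ = 0)).resolve_left
      (Lagrange.nodalWeight_ne_zero h.injOn (Finset.mem_univ j))
    rw [← smul_eq_mul, ← dotProduct_smul, ← polyTwist_mulVec_single, Matrix.dotProduct_mulVec,
      hr, zero_dotProduct]

theorem twist_eq_gauge_mul_polyTwist (γ : ℂ) (f0 : ℂ → ℂ) (u : ℂ) (lam : Fin n → ℂ) :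
    twist γ f0 u lam =
      gauge n (sigma lam + u + f0 (sigma lam + u))⁻¹ * polyTwist (sigma lam + u + γ) lam := by
  ext i j
  simp only [twist, gauge, Matrix.diagonal_mul, polyTwist, Matrix.of_apply, twistVec_apply,
    Lagrange.nodalWeight, Finset.prod_inv_distrib]
  split_ifs
  · rw [div_mul_eq_div_div]
    ring
  · ring

theorem gConj_twist_eq_gauge_mul_polyTwist (γ : ℂ) (f0 : ℂ → ℂ) (u : ℂ) (lam : Fin n → ℂ) :
    gConj γ 1 (twist γ f0) u lam =
      gauge n (sigma lam + u - γ + f0 (sigma lam + u - γ))⁻¹ * polyTwist (sigma lam + u) lam := by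
  rw [gConj, one_mul, twist_eq_gauge_mul_polyTwist, ← add_sub_assoc, sub_add_cancel]

theorem isUnit_twist {γ : ℂ} {f0 : ℂ → ℂ} {u : ℂ} (h : Function.Injective lam) (hu : u + γ ≠ 0)
    (hU : sigma lam + u + f0 (sigma lam + u) ≠ 0) : IsUnit (twist γ f0 u lam) := by
  rw [twist_eq_gauge_mul_polyTwist]
  exact (isUnit_gauge (inv_ne_zero hU)).mul
    (isUnit_polyTwist h (by rwa [add_assoc, ne_eq, add_eq_left]))

theorem isUnit_gConj_twist {γ : ℂ} {f0 : ℂ → ℂ} {u : ℂ} (h : Function.Injective lam) (hu : u ≠ 0)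
    (hU : sigma lam + u - γ + f0 (sigma lam + u - γ) ≠ 0) :
    IsUnit (gConj γ 1 (twist γ f0) u lam) := by
  rw [gConj_twist_eq_gauge_mul_polyTwist]
  exact (isUnit_gauge (inv_ne_zero hU)).mul (isUnit_polyTwist h (by rwa [ne_eq, add_eq_left]))

end Twist

/-! ### Dynamical shifts -/

section Shift

variable {n : ℕ} {γ : ℂ} {lam : Fin n → ℂ}

theorem shift_self (γ : ℂ) (j : Fin n) (lam : Fin n → ℂ) : shift γ j lam j = lam j + γ := by
  rw [shift, Pi.add_apply, Pi.single_eq_same]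

theorem shift_of_ne (γ : ℂ) {j k : Fin n} (h : k ≠ j) (lam : Fin n → ℂ) :
    shift γ j lam k = lam k := by
  rw [shift, Pi.add_apply, Pi.single_eq_of_ne h, add_zero]

theorem sigma_shift (γ : ℂ) (j : Fin n) (lam : Fin n → ℂ) :
    sigma (shift γ j lam) = sigma lam + γ := by
  simp only [sigma, shift, Pi.add_apply, Finset.sum_add_distrib, Finset.sum_pi_single',
    Finset.mem_univ, if_true]

theorem Generic.injective (h : Generic γ lam) : Function.Injective lam := fun i j hij => by
  by_contra hne
  exact (h i j hne).1 (sub_eq_zero.2 hij)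

theorem Generic.add_ne (hγ : γ ≠ 0) (h : Generic γ lam) (p j : Fin n) : lam p + γ ≠ lam j := by
  rcases eq_or_ne j p with rfl | hjp
  · rwa [ne_eq, add_eq_left]
  · exact fun heq => (h j p hjp).2 (sub_eq_iff_eq_add'.2 heq.symm)

theorem Generic.injective_shift (hγ : γ ≠ 0) (h : Generic γ lam) (p : Fin n) :
    Function.Injective (shift γ p lam) := by
  have hp {j : Fin n} (hj : j ≠ p) : shift γ p lam p ≠ shift γ p lam j := by
    rw [shift_self, shift_of_ne γ hj]
    exact h.add_ne hγ p j
  intro i j hij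
  rcases eq_or_ne i p with rfl | hi
  · by_contra hj
    exact hp (Ne.symm hj) hij
  · rcases eq_or_ne j p with rfl | hj
    · exact absurd hij.symm (hp hi)
    · rw [shift_of_ne γ hi, shift_of_ne γ hj] at hij
      exact h.injective hij

theorem nodalWeight_shift_of_ne (h : Generic γ lam) {p q : Fin n} (hpq : p ≠ q) :
    Lagrange.nodalWeight Finset.univ (shift γ p lam) q =
      Lagrange.nodalWeight Finset.univ lam q * ((lam q - lam p) / (lam q - lam p - γ)) := by
  have hne := (h q p hpq.symm).1
  have hne' := sub_ne_zero.2 (h q p hpq.symm).2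
  have hp : p ∈ Finset.univ.erase q := Finset.mem_erase.2 ⟨hpq, Finset.mem_univ p⟩
  simp only [Lagrange.nodalWeight]
  rw [← Finset.mul_prod_erase _ _ hp, ← Finset.mul_prod_erase _ _ hp, shift_self,
    shift_of_ne γ hpq.symm, Finset.prod_congr rfl fun a ha => by
      rw [shift_of_ne γ (Finset.ne_of_mem_erase ha)], ← sub_sub]
  field_simp

theorem nodalWeight_shift_self (hγ : γ ≠ 0) (p : Fin n) :
    Lagrange.nodalWeight Finset.univ (shift γ p lam) p =
      γ * ((Lagrange.nodal Finset.univ lam).eval (lam p + γ))⁻¹ := by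
  rw [Lagrange.nodalWeight, Lagrange.eval_nodal, ← Finset.mul_prod_erase _ _ (Finset.mem_univ p),
    shift_self, Finset.prod_congr rfl fun a ha => by rw [shift_of_ne γ (Finset.ne_of_mem_erase ha)],
    add_sub_cancel_left, mul_inv, Finset.prod_inv_distrib, mul_inv_cancel_left₀ hγ]

theorem gConj_twist_shift (γ : ℂ) (f0 : ℂ → ℂ) (u : ℂ) (lam : Fin n → ℂ) (j : Fin n) :
    gConj γ 1 (twist γ f0) u (shift γ j lam) =
      gauge n (sigma lam + u + f0 (sigma lam + u))⁻¹ *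
        polyTwist (sigma lam + u + γ) (shift γ j lam) := by
  rw [gConj_twist_eq_gauge_mul_polyTwist, sigma_shift, add_right_comm, add_sub_cancel_right]

theorem isUnit_gConj_twist_shift (hγ : γ ≠ 0) (h : Generic γ lam) {f0 : ℂ → ℂ} {u : ℂ}
    (hu : u ≠ 0) (hU : sigma lam + u + f0 (sigma lam + u) ≠ 0) (j : Fin n) :
    IsUnit (gConj γ 1 (twist γ f0) u (shift γ j lam)) := by
  refine isUnit_gConj_twist (h.injective_shift hγ j) hu ?_
  rwa [sigma_shift, add_right_comm, add_sub_cancel_right]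

theorem dyn1h2_mulVec (γ : ℂ) (M : (Fin n → ℂ) → Mat n) (lam y : Fin n → ℂ) (q : Fin n) :
    dyn1h2 γ M lam *ᵥ (y ⊠ Pi.single q 1) = (M (shift γ q lam) *ᵥ y) ⊠ Pi.single q 1 := by
  rw [dyn1h2_eq_flip, flip_mulVec, tmul_comp_swap, dyn2h1_mulVec, tmul_comp_swap]

theorem dyn1h2_mul_dyn1h2_eq_one {M N : (Fin n → ℂ) → Mat n}
    (h : ∀ j, M (shift γ j lam) * N (shift γ j lam) = 1) :
    dyn1h2 γ M lam * dyn1h2 γ N lam = 1 := by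
  refine ext_mulVec_single_tmul_single fun i j => ?_
  rw [← Matrix.mulVec_mulVec, dyn1h2_mulVec, dyn1h2_mulVec, Matrix.mulVec_mulVec, h,
    Matrix.one_mulVec, Matrix.one_mulVec]

theorem dyn2h1_gConj_twist (γ : ℂ) (f0 : ℂ → ℂ) (u : ℂ) (lam : Fin n → ℂ) :
    dyn2h1 γ (gConj γ 1 (twist γ f0) u) lam =
      sp2 (gauge n (sigma lam + u + f0 (sigma lam + u))⁻¹) *
        dyn2h1 γ (polyTwist (sigma lam + u + γ)) lam := by
  refine ext_mulVec_single_tmul_single fun i j => ?_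
  rw [← Matrix.mulVec_mulVec, dyn2h1_mulVec, dyn2h1_mulVec, sp2_mulVec_tmul, gConj_twist_shift,
    Matrix.mulVec_mulVec]

theorem dyn1h2_gConj_twist (γ : ℂ) (f0 : ℂ → ℂ) (u : ℂ) (lam : Fin n → ℂ) :
    dyn1h2 γ (gConj γ 1 (twist γ f0) u) lam =
      sp1 (gauge n (sigma lam + u + f0 (sigma lam + u))⁻¹) *
        dyn1h2 γ (polyTwist (sigma lam + u + γ)) lam := by
  simp only [dyn1h2_eq_flip, sp1_eq_flip, ← flip_mul, dyn2h1_gConj_twist]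

end Shift

/-! ### Parametrizations of the structure matrices -/

section Parametrization

variable {n : ℕ} {γ : ℂ} {f0 : ℂ → ℂ} {u v : ℂ} {lam : Fin n → ℂ}

theorem sp1_inv_mul {M : Mat n} (h : IsUnit M) : sp1 M⁻¹ * sp1 M = 1 := by
  rw [sp1, sp1, ← Matrix.mul_kronecker_mul, Matrix.nonsing_inv_mul _
    ((Matrix.isUnit_iff_isUnit_det _).1 h), one_mul, Matrix.one_kronecker_one]

theorem sp2_inv_mul {M : Mat n} (h : IsUnit M) : sp2 M⁻¹ * sp2 M = 1 := by
  rw [sp2, sp2, ← Matrix.mul_kronecker_mul, Matrix.nonsing_inv_mul _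
    ((Matrix.isUnit_iff_isUnit_det _).1 h), one_mul, Matrix.one_kronecker_one]

theorem sp1_mul (M N : Mat n) : sp1 (M * N) = sp1 M * sp1 N := by
  rw [sp1, sp1, sp1, ← Matrix.mul_kronecker_mul, one_mul]

theorem sp2_mul (M N : Mat n) : sp2 (M * N) = sp2 M * sp2 N := by
  rw [sp2, sp2, sp2, ← Matrix.mul_kronecker_mul, one_mul]

theorem sp1_mul_sp2 (M N : Mat n) : sp1 M * sp2 N = M ⊗ₖ N := by
  rw [sp1, sp2, ← Matrix.mul_kronecker_mul, mul_one, one_mul]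

theorem sp2_mul_sp1 (M N : Mat n) : sp2 N * sp1 M = M ⊗ₖ N := by
  rw [sp1, sp2, ← Matrix.mul_kronecker_mul, mul_one, one_mul]

theorem sp2_polyTwist_mul_B (hγ : γ ≠ 0) (h : Generic γ lam) (hv : v + γ ≠ 0) :
    sp2 (polyTwist (sigma lam + v + γ) lam) * B γ v lam =
      dyn2h1 γ (polyTwist (sigma lam + v + γ)) lam := by
  refine ext_mulVec_single_tmul_single fun p q => ?_
  rw [← Matrix.mulVec_mulVec, B_mulVec, sp2_mulVec_tmul, dyn2h1_mulVec, polyTwist_mulVec_single]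
  congr 1
  rcases eq_or_ne p q with rfl | hpq
  · have hone : (γ / (v + γ)) • (sigma lam + v + γ - sigma lam) • lastVec n = γ • lastVec n := by
      rw [smul_smul, add_assoc, add_sub_cancel_left, div_mul_cancel₀ _ hv]
    have hsum : polyTwist (sigma lam + v + γ) lam *ᵥ (fun i => y γ lam i p) =
        -γ • ∑ i, (Lagrange.nodalWeight Finset.univ lam i / (lam p + γ - lam i)) •
          twistVec (sigma lam + v + γ) (lam i) := by
      rw [polyTwist_mulVec, Finset.smul_sum]
      refine Finset.sum_congr rfl fun i _ => ?_
      rw [smul_smul, y, sub_sub, ← neg_sub (lam p + γ) (lam i), div_neg]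
      ring_nf
    have hy : 1 + y γ lam p p = 0 := by
      rw [y, sub_self, zero_sub, div_neg, div_self hγ, add_neg_cancel]
    rw [hy, zero_smul, if_pos rfl, zero_sub, Matrix.mulVec_neg, Matrix.mulVec_add,
      Matrix.mulVec_smul, polyTwist_mulVec_one h.injective, hone, hsum,
      sum_nodalWeight_div_smul_twistVec h.injective _ (h.add_ne hγ p), nodalWeight_shift_self hγ,
      shift_self]
    module
  · have hy : 1 + y γ lam q p = (lam q - lam p) / (lam q - lam p - γ) := by
      have hne := sub_ne_zero.2 (h q p hpq.symm).2
      rw [y]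
      field_simp
      ring
    rw [if_neg hpq, sub_zero, Matrix.mulVec_smul, polyTwist_mulVec_single, smul_smul, hy,
      nodalWeight_shift_of_ne h hpq, shift_of_ne γ hpq.symm, mul_comm]

theorem B_eq (hγ : γ ≠ 0) (h : Generic γ lam) (hv : v + γ ≠ 0)
    (hV : sigma lam + v + f0 (sigma lam + v) ≠ 0) :
    B γ v lam = sp2 (twist γ f0 v lam)⁻¹ * dyn2h1 γ (gConj γ 1 (twist γ f0) v) lam := by
  have htwist : sp2 (twist γ f0 v lam) * B γ v lam =
      dyn2h1 γ (gConj γ 1 (twist γ f0) v) lam := by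
    rw [twist_eq_gauge_mul_polyTwist, sp2_mul, mul_assoc, sp2_polyTwist_mul_B hγ h hv,
      dyn2h1_gConj_twist]
  rw [← htwist, ← mul_assoc, sp2_inv_mul (isUnit_twist h.injective hv hV), one_mul]

theorem C_eq (hγ : γ ≠ 0) (h : Generic γ lam) (hu : u + γ ≠ 0)
    (hU : sigma lam + u + f0 (sigma lam + u) ≠ 0) :
    C γ u lam = sp1 (twist γ f0 u lam)⁻¹ * dyn1h2 γ (gConj γ 1 (twist γ f0) u) lam := by
  rw [C, B_eq hγ h hu hU, flip_mul, ← sp1_eq_flip, ← dyn1h2_eq_flip]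

theorem div_sub_mul_add_sub_add_sub (γ t : ℂ) (huv : u ≠ v) :
    γ / (u - v) * (t + u + γ - (t + v) - γ) = γ := by
  have huv' := sub_ne_zero.2 huv
  field_simp
  ring

theorem neg_x (γ : ℂ) (lam : Fin n → ℂ) (i : Fin n) : -x γ lam i = fun j => x γ lam j i := by
  ext j
  rw [Pi.neg_apply, x, x, ← div_neg, neg_sub]

theorem polyTwist_mulVec_smul_one_add (h : Function.Injective lam) {a p : ℂ}
    (ha : a * (p - sigma lam) = γ) (i : Fin n) :
    polyTwist p lam *ᵥ (a • 1 + fun j => x γ lam j i) =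
      γ • lastVec n +
        ∑ j, (x γ lam j i * Lagrange.nodalWeight Finset.univ lam j) • twistVec p (lam j) := by
  rw [Matrix.mulVec_add, Matrix.mulVec_smul, polyTwist_mulVec_one h, polyTwist_mulVec,
    smul_smul, ha]

theorem polyTwist_kronecker_mul_A (h : Function.Injective lam) (huv : u ≠ v) (hu : u + γ ≠ 0)
    (hv : v ≠ 0) :
    (polyTwist (sigma lam + u + γ) lam ⊗ₖ polyTwist (sigma lam + v) lam) * A γ u v lam =
      polyR n γ (γ / (u - v)) (sigma lam + u + γ) (sigma lam + v) *
        (polyTwist (sigma lam + u) lam ⊗ₖ polyTwist (sigma lam + v + γ) lam) := by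
  have hs := div_sub_mul_add_sub_add_sub γ (sigma lam) huv
  refine ext_mulVec_single_tmul_single fun i j => ?_
  rw [← Matrix.mulVec_mulVec, ← Matrix.mulVec_mulVec, A_mulVec, kronecker_mulVec_tmul,
    polyTwist_mulVec_single, polyTwist_mulVec_single]
  simp only [map_smul, LinearMap.smul_apply, Matrix.mulVec_smul]
  rcases eq_or_ne i j with rfl | hij
  · have hR := polyR_mulVec_self (n := n) hs (lam i)
    rw [add_sub_cancel_right] at hR
    have hleft := polyTwist_mulVec_smul_one_add h (p := sigma lam + u + γ) (a := γ / (u + γ))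
      (by rw [add_assoc, add_sub_cancel_left, div_mul_cancel₀ _ hu]) i
    have hright := polyTwist_mulVec_smul_one_add h (p := sigma lam + v) (a := γ / v)
      (by rw [add_sub_cancel_left, div_mul_cancel₀ _ hv]) i
    rw [← neg_x, ← sub_eq_add_neg] at hright
    have hxi : x γ lam i i = 0 := by rw [x, sub_self, div_zero]
    have hsum := smul_tmul_lastVec_sub h γ (sigma lam + u + γ) (sigma lam + v) i
    simp only [smul_sub, Finset.sum_sub_distrib] at hsum
    rw [if_pos rfl, hxi, hR, Matrix.mulVec_add, Matrix.mulVec_add, Matrix.mulVec_sub,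
      Matrix.mulVec_smul, Matrix.mulVec_smul, kronecker_mulVec_tmul, kronecker_mulVec_tmul,
      kronecker_mulVec_tmul, hleft, hright, polyTwist_mulVec_single, polyTwist_mulVec_single]
    simp only [map_smul, LinearMap.smul_apply]
    simp only [map_add, map_smul, map_sum, LinearMap.add_apply, LinearMap.smul_apply,
      LinearMap.sum_apply]
    linear_combination (norm := module) Lagrange.nodalWeight Finset.univ lam i • hsum
  · have hR := polyR_mulVec_of_ne (n := n) hs (h.ne hij)
    rw [add_sub_cancel_right] at hR
    rw [if_neg hij, add_zero, hR, Matrix.mulVec_add, Matrix.mulVec_smul, Matrix.mulVec_smul,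
      kronecker_mulVec_tmul, kronecker_mulVec_tmul]
    simp only [polyTwist_mulVec_single, map_smul, LinearMap.smul_apply, x,
      ← neg_sub (lam i) (lam j), div_neg]
    module

theorem R_mul_gauge_inv_kronecker_gauge_inv {f0 : ℂ} (hU : sigma lam + u - γ + f0 ≠ 0)
    (hV : sigma lam + v + f0 ≠ 0) :
    R γ f0 u v lam *
        (gauge n (sigma lam + u - γ + f0)⁻¹ ⊗ₖ gauge n (sigma lam + v + f0)⁻¹) =
      (gauge n (sigma lam + u + f0)⁻¹ ⊗ₖ gauge n (sigma lam + v - γ + f0)⁻¹) *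
        polyR n γ (γ / (u - v)) (sigma lam + u + γ) (sigma lam + v) := by
  rw [R_eq_gauge_mul_polyR_mul_gauge, mul_assoc, ← Matrix.mul_kronecker_mul,
    gauge_mul_gauge_inv hU, gauge_mul_gauge_inv hV, Matrix.one_kronecker_one, mul_one]

theorem A_eq (h : Function.Injective lam) {f0 : ℂ} (huv : u ≠ v) (hu : u + γ ≠ 0) (hv : v ≠ 0)
    (hU : sigma lam + u + f0 ≠ 0) (hV : sigma lam + v + f0 ≠ 0)
    (hU' : sigma lam + u - γ + f0 ≠ 0) (hV' : sigma lam + v - γ + f0 ≠ 0) :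
    A γ u v lam =
      sp1 (twist γ (fun _ => f0) u lam)⁻¹ * sp2 (gConj γ 1 (twist γ fun _ => f0) v lam)⁻¹ *
        R γ f0 u v lam * sp1 (gConj γ 1 (twist γ fun _ => f0) u lam) *
        sp2 (twist γ (fun _ => f0) v lam) := by
  have hA : sp2 (gConj γ 1 (twist γ fun _ => f0) v lam) * sp1 (twist γ (fun _ => f0) u lam) *
      A γ u v lam = R γ f0 u v lam * (sp1 (gConj γ 1 (twist γ fun _ => f0) u lam) *
        sp2 (twist γ (fun _ => f0) v lam)) := by
    rw [sp1_mul_sp2, sp2_mul_sp1, twist_eq_gauge_mul_polyTwist, twist_eq_gauge_mul_polyTwist,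
      gConj_twist_eq_gauge_mul_polyTwist, gConj_twist_eq_gauge_mul_polyTwist,
      Matrix.mul_kronecker_mul, Matrix.mul_kronecker_mul, mul_assoc,
      polyTwist_kronecker_mul_A h huv hu hv, ← mul_assoc, ← mul_assoc,
      R_mul_gauge_inv_kronecker_gauge_inv hU' hV]
  have hu₁ := sp1_inv_mul (isUnit_twist (f0 := fun _ => f0) h hu hU)
  have hv₂ := sp2_inv_mul (isUnit_gConj_twist (f0 := fun _ => f0) h hv hV')
  rw [mul_assoc, mul_assoc _ (R γ f0 u v lam), ← hA, mul_assoc, mul_assoc,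
    ← mul_assoc (sp2 _⁻¹), hv₂, one_mul, ← mul_assoc, hu₁, one_mul]

theorem polyTwist_mul_D (hγ : γ ≠ 0) (h : Generic γ lam) (huv : u ≠ v) :
    sp2 (polyTwist (sigma lam + v) lam) *
        (dyn1h2 γ (polyTwist (sigma lam + u + γ)) lam * D γ (u - v) lam) =
      polyR n γ (γ / (u - v)) (sigma lam + u + γ) (sigma lam + v) *
        (sp1 (polyTwist (sigma lam + u) lam) *
          dyn2h1 γ (polyTwist (sigma lam + v + γ)) lam) := by
  have hs := div_sub_mul_add_sub_add_sub γ (sigma lam) huv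
  refine ext_mulVec_single_tmul_single fun i j => ?_
  simp only [← Matrix.mulVec_mulVec, D_mulVec, Matrix.mulVec_add, Matrix.mulVec_smul,
    dyn1h2_mulVec, dyn2h1_mulVec, sp1_mulVec_tmul, sp2_mulVec_tmul, polyTwist_mulVec_single,
    map_smul, LinearMap.smul_apply]
  rcases eq_or_ne i j with rfl | hij
  · -- The labels `λ_i` and `λ_i + γ` differ by `γ`, so only the permuted term survives.
    have hne : lam i ≠ shift γ i lam i := by rwa [shift_self, ne_eq, left_eq_add]
    have hR := polyR_mulVec_of_ne (n := n) hs hne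
    rw [add_sub_cancel_right, shift_self, sub_add_cancel_left, div_neg, div_self hγ] at hR
    have hxi : x γ lam i i = 0 := by rw [x, sub_self, div_zero]
    rw [shift_self, hxi, hR]
    module
  · have hR := polyR_mulVec_of_ne (n := n) hs (h.injective.ne hij)
    rw [add_sub_cancel_right] at hR
    rw [shift_of_ne γ hij, shift_of_ne γ hij.symm, nodalWeight_shift_of_ne h hij,
      nodalWeight_shift_of_ne h hij.symm, hR]
    have h₁ := sub_ne_zero.2 (h i j hij).2
    have h₂ := sub_ne_zero.2 (h j i hij.symm).2
    have h₃ := (h i j hij).1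
    have h₄ := (h j i hij.symm).1
    simp only [x]
    match_scalars
    · field_simp
      ring
    · field_simp
      ring

theorem D_eq (hγ : γ ≠ 0) (h : Generic γ lam) {f0 : ℂ} (huv : u ≠ v) (hu : u ≠ 0) (hv : v ≠ 0)
    (hU : sigma lam + u + f0 ≠ 0) (hV : sigma lam + v + f0 ≠ 0)
    (hU' : sigma lam + u - γ + f0 ≠ 0) (hV' : sigma lam + v - γ + f0 ≠ 0) :
    D γ (u - v) lam =
      dyn1h2 γ (fun mu => (gConj γ 1 (twist γ fun _ => f0) u mu)⁻¹) lam *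
        sp2 (gConj γ 1 (twist γ fun _ => f0) v lam)⁻¹ *
        R γ f0 u v lam * sp1 (gConj γ 1 (twist γ fun _ => f0) u lam) *
        dyn2h1 γ (gConj γ 1 (twist γ fun _ => f0) v) lam := by
  have hD : sp2 (gConj γ 1 (twist γ fun _ => f0) v lam) *
      (dyn1h2 γ (gConj γ 1 (twist γ fun _ => f0) u) lam * D γ (u - v) lam) =
      R γ f0 u v lam * (sp1 (gConj γ 1 (twist γ fun _ => f0) u lam) *
        dyn2h1 γ (gConj γ 1 (twist γ fun _ => f0) v) lam) := by
    simp only [dyn2h1_gConj_twist, dyn1h2_gConj_twist, gConj_twist_eq_gauge_mul_polyTwist, sp2_mul,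
      sp1_mul]
    simp only [mul_assoc]
    rw [← mul_assoc (sp2 (polyTwist _ _)) (sp1 _), sp2_mul_sp1, ← sp1_mul_sp2, mul_assoc,
      polyTwist_mul_D hγ h huv, ← mul_assoc (sp1 (polyTwist _ _)) (sp2 _), sp1_mul_sp2,
      ← sp2_mul_sp1 (polyTwist _ _), mul_assoc (sp2 _), ← mul_assoc (sp1 _) (sp2 _), sp1_mul_sp2,
      ← mul_assoc (sp2 _) (sp1 _), sp2_mul_sp1]
    rw [← mul_assoc, ← R_mul_gauge_inv_kronecker_gauge_inv hU' hV, mul_assoc]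
  have hu₁ : dyn1h2 γ (fun mu => (gConj γ 1 (twist γ fun _ => f0) u mu)⁻¹) lam *
      dyn1h2 γ (gConj γ 1 (twist γ fun _ => f0) u) lam = 1 :=
    dyn1h2_mul_dyn1h2_eq_one fun j => Matrix.nonsing_inv_mul _ ((Matrix.isUnit_iff_isUnit_det _).1
      (isUnit_gConj_twist_shift (f0 := fun _ => f0) hγ h hu hU j))
  have hv₂ := sp2_inv_mul (isUnit_gConj_twist (f0 := fun _ => f0) h.injective hv hV')
  rw [mul_assoc, mul_assoc _ (R γ f0 u v lam), ← hD, mul_assoc, ← mul_assoc (sp2 _⁻¹), hv₂,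
    one_mul, ← mul_assoc, hu₁, one_mul]

end Parametrization

/-! ### Dependence on the dynamical variable -/

section DeDynamization

variable {n : ℕ} {γ u v : ℂ}

theorem R_shift (γ f0 u v : ℂ) (lam : Fin n → ℂ) (j : Fin n) :
    R γ f0 (u - γ) (v - γ) (shift γ j lam) = R γ f0 u v lam := by
  simp only [R, sigma_shift]
  generalize sigma lam = σ
  rw [show u - γ - (v - γ) = u - v by ring, show σ + γ + (u - γ) = σ + u by ring,
    show σ + γ + (v - γ) = σ + v by ring]

theorem leg12_R_eq_dyn12h3 (γ f0 u v : ℂ) (lam : Fin n → ℂ) :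
    leg12 (R γ f0 u v lam) = dyn12h3 γ (gConj2 γ 1 (R γ f0) u v) lam := by
  simp only [leg12, dyn12h3, gConj2, one_mul, R_shift]

theorem R_eq_R0 (hn : 1 ≤ n) {lam : Fin n → ℂ} (hU : sigma lam + u + γ ≠ 0)
    (hW : sigma lam + v ≠ 0) : R γ γ u v lam = R0 n γ (u + sigma lam) (v + sigma lam) := by
  obtain ⟨m, rfl⟩ := Nat.exists_eq_add_of_le' hn
  simp only [R, R0, Nat.add_sub_cancel]
  generalize sigma lam = σ at *
  rw [add_comm] at hW
  rw [add_comm σ u] at hU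
  rw [add_sub_add_right_eq_sub, sub_add_cancel, sub_add_cancel, add_comm σ u, add_comm σ v,
    div_self hU, div_self hW, mul_one, Finset.sum_Icc_succ_top (by omega), Nat.add_sub_cancel,
    mul_comm (v + σ + γ) (u + σ), mul_comm (u + σ + γ) (v + σ)]
  simp only [Finset.sum_sub_distrib]
  module

theorem R_eq_gConj2_R0 (hn : 1 ≤ n) (hγ : γ ≠ 0) {lam : Fin n → ℂ} (hU : sigma lam + u + γ ≠ 0)
    (hW : sigma lam + v ≠ 0) :
    R γ γ u v lam = gConj2 γ (-(sigma lam / γ)) (R0 n γ) u v := by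
  rw [R_eq_R0 hn hU hW, gConj2, neg_mul, div_mul_cancel₀ _ hγ, sub_neg_eq_add, sub_neg_eq_add]

theorem gauge_kronecker_mul_R0 (hn : 1 ≤ n) (hu : u + γ ≠ 0) (hv : v ≠ 0) :
    (gauge n (u + γ) ⊗ₖ gauge n v) * R0 n γ u v =
      polyR n γ (γ / (u - v)) (u + γ) v * (gauge n u ⊗ₖ gauge n (v + γ)) := by
  have hσ : sigma (0 : Fin n → ℂ) = 0 := by simp only [sigma, Pi.zero_apply, Finset.sum_const_zero]
  have hR := R_eq_R0 hn (γ := γ) (u := u) (v := v) (lam := 0) (by rwa [hσ, zero_add])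
    (by rwa [hσ, zero_add])
  rw [R_eq_gauge_mul_polyR_mul_gauge] at hR
  simp only [hσ, zero_add, add_zero, sub_add_cancel] at hR
  rw [← hR, ← mul_assoc, ← mul_assoc, ← Matrix.mul_kronecker_mul, gauge_mul_gauge_inv hu,
    gauge_mul_gauge_inv hv, Matrix.one_kronecker_one, one_mul]

theorem R0_apply_last (m : ℕ) (hu : u + γ ≠ 0) (hv : v ≠ 0) :
    (u + γ) * v * R0 (m + 1) γ u v (Fin.last m, Fin.last m) (Fin.last m, Fin.last m) =
      u * (v + γ) * (1 + γ / (u - v)) := by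
  have h := congrFun₂ (gauge_kronecker_mul_R0 m.succ_pos hu hv) (Fin.last m, Fin.last m)
    (Fin.last m, Fin.last m)
  simp only [gauge, Matrix.diagonal_kronecker_diagonal, Matrix.diagonal_mul, Matrix.mul_diagonal,
    Fin.val_last, if_true, polyR, Matrix.of_apply, Prod.swap_prod_mk, mul_zero, add_zero] at h
  rw [h, mul_comm]

theorem not_exists_R0_eq_sub (hn : 1 ≤ n) (hγ : γ ≠ 0) :
    ¬ ∃ F : ℂ → Mat2 n, ∀ u v : ℂ, u ≠ v → u + γ ≠ 0 → v ≠ 0 → R0 n γ u v = F (u - v) := by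
  rintro ⟨F, hF⟩
  obtain ⟨m, rfl⟩ := Nat.exists_eq_add_of_le' hn
  have hcorner (v : ℂ) (hv : v ≠ 0) (hv' : v + γ + γ ≠ 0) :
      (v + γ + γ) * v * F γ (Fin.last m, Fin.last m) (Fin.last m, Fin.last m) =
        (v + γ) * (v + γ) * 2 := by
    have h := R0_apply_last m hv' hv
    rwa [hF (v + γ) v (by rwa [ne_eq, add_eq_left]) hv' hv, add_sub_cancel_left, div_self hγ,
      one_add_one_eq_two] at h
  have h₁ := hcorner γ hγ (by
    rw [show γ + γ + γ = 3 * γ by ring]; exact mul_ne_zero (by norm_num) hγ)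
  have h₂ := hcorner (2 * γ) (mul_ne_zero two_ne_zero hγ) (by
    rw [show 2 * γ + γ + γ = 4 * γ by ring]; exact mul_ne_zero (by norm_num) hγ)
  have hsq : γ ^ 2 = 0 := by linear_combination (3 / 10 : ℂ) * h₂ - (4 / 5 : ℂ) * h₁
  exact hγ (pow_eq_zero_iff two_ne_zero |>.1 hsq)

end DeDynamization

/-! ### Legs of a triple tensor product -/

section Legs

variable {n : ℕ}

theorem leg23_eq_kronecker (M : Mat2 n) : leg23 M = (1 : Mat n) ⊗ₖ M := by
  ext s t
  simp only [leg23, Matrix.of_apply, Matrix.kroneckerMap_apply, Matrix.one_apply, ite_mul, one_mul,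
    zero_mul]

theorem leg12_eq_submatrix (M : Mat2 n) :
    leg12 M = (M ⊗ₖ (1 : Mat n)).submatrix (Equiv.prodAssoc _ _ _).symm
      (Equiv.prodAssoc _ _ _).symm := by
  ext s t
  simp only [leg12, Matrix.of_apply, Matrix.submatrix_apply, Equiv.prodAssoc_symm_apply,
    Matrix.kroneckerMap_apply, Matrix.one_apply, mul_ite, mul_one, mul_zero]

/-- The exchange of the first two factors of a triple product, which turns leg 23 into leg 13. -/
def swap12 (ι : Type*) : ι × ι × ι ≃ ι × ι × ι where
  toFun t := (t.2.1, t.1, t.2.2)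
  invFun t := (t.2.1, t.1, t.2.2)

theorem leg13_eq_submatrix (M : Mat2 n) :
    leg13 M = (leg23 M).submatrix (swap12 _) (swap12 _) := rfl

theorem leg23_mulVec_tmul (M : Mat2 n) (x : Fin n → ℂ) (w : Fin n × Fin n → ℂ) :
    leg23 M *ᵥ (x ⊠ w) = x ⊠ (M *ᵥ w) := by
  rw [leg23_eq_kronecker, kronecker_mulVec_tmul, Matrix.one_mulVec]

theorem leg13_mulVec_tmul (M : Mat2 n) (x y z : Fin n → ℂ) :
    leg13 M *ᵥ (x ⊠ y ⊠ z) = (y ⊠ (M *ᵥ (x ⊠ z))) ∘ swap12 _ := by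
  have hswap : x ⊠ y ⊠ z = (y ⊠ x ⊠ z) ∘ swap12 _ := funext fun _ => mul_left_comm _ _ _
  rw [hswap, leg13_eq_submatrix, Matrix.submatrix_mulVec_equiv, Function.comp_assoc,
    Equiv.self_comp_symm, Function.comp_id, leg23_mulVec_tmul]

theorem leg12_mulVec_tmul (M : Mat2 n) (x y z : Fin n → ℂ) :
    leg12 M *ᵥ (x ⊠ y ⊠ z) = ((M *ᵥ (x ⊠ y)) ⊠ z) ∘ (Equiv.prodAssoc _ _ _).symm := by
  have hassoc : x ⊠ y ⊠ z = ((x ⊠ y) ⊠ z) ∘ (Equiv.prodAssoc _ _ _).symm :=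
    funext fun _ => (mul_assoc _ _ _).symm
  rw [hassoc, leg12_eq_submatrix, Matrix.submatrix_mulVec_equiv, Function.comp_assoc,
    Equiv.self_comp_symm, Function.comp_id, kronecker_mulVec_tmul, Matrix.one_mulVec]

variable {M N : Mat2 n} {P P' Q Q' : Mat n}

theorem kronecker_mul_leg23 (h : (P ⊗ₖ Q) * M = N * (P' ⊗ₖ Q')) (S : Mat n) :
    (S ⊗ₖ (P ⊗ₖ Q)) * leg23 M = leg23 N * (S ⊗ₖ (P' ⊗ₖ Q')) := by
  rw [leg23_eq_kronecker, leg23_eq_kronecker, ← Matrix.mul_kronecker_mul,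
    ← Matrix.mul_kronecker_mul, h, mul_one, one_mul]

theorem kronecker_mul_leg13 (h : (P ⊗ₖ Q) * M = N * (P' ⊗ₖ Q')) (S : Mat n) :
    (P ⊗ₖ (S ⊗ₖ Q)) * leg13 M = leg13 N * (P' ⊗ₖ (S ⊗ₖ Q')) := by
  have hswap (K L : Mat n) :
      K ⊗ₖ (S ⊗ₖ L) = (S ⊗ₖ (K ⊗ₖ L)).submatrix (swap12 _) (swap12 _) := by
    ext s t
    exact mul_left_comm _ _ _
  rw [hswap, hswap, leg13_eq_submatrix, leg13_eq_submatrix, Matrix.submatrix_mul_equiv,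
    Matrix.submatrix_mul_equiv, kronecker_mul_leg23 h]

theorem kronecker_mul_leg12 (h : (P ⊗ₖ Q) * M = N * (P' ⊗ₖ Q')) (S : Mat n) :
    (P ⊗ₖ (Q ⊗ₖ S)) * leg12 M = leg12 N * (P' ⊗ₖ (Q' ⊗ₖ S)) := by
  have hassoc (K L : Mat n) : K ⊗ₖ (L ⊗ₖ S) =
      ((K ⊗ₖ L) ⊗ₖ S).submatrix (Equiv.prodAssoc _ _ _).symm (Equiv.prodAssoc _ _ _).symm := by
    ext s t
    exact (mul_assoc _ _ _).symm
  rw [hassoc, hassoc, leg12_eq_submatrix, leg12_eq_submatrix, Matrix.submatrix_mul_equiv,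
    Matrix.submatrix_mul_equiv, ← Matrix.mul_kronecker_mul, ← Matrix.mul_kronecker_mul, h, mul_one,
    one_mul]

end Legs

/-! ### The deformed Yang–Baxter equation -/

section YangBaxter

variable {n : ℕ}

theorem dotProduct_lastVec_eq_zero {p : ℂ} {S : Finset ℂ} {r : Fin n → ℂ}
    (h : ∀ z ∉ S, r ⬝ᵥ twistVec p z = 0) : r ⬝ᵥ lastVec n = 0 := by
  let P : ℂ[X] := ∑ i, Polynomial.C (r i) * twistPoly p i
  have hP : P = 0 := by
    refine P.eq_zero_of_infinite_isRoot (S.finite_toSet.infinite_compl.mono fun z hz => ?_)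
    simp only [Set.mem_ofPred_eq, Polynomial.IsRoot, P, Polynomial.eval_finsetSum,
      Polynomial.eval_mul, Polynomial.eval_C]
    exact h z hz
  have hcoeff : P.coeff n = -(r ⬝ᵥ lastVec n) := by
    simp only [P, Polynomial.finsetSum_coeff, Polynomial.coeff_C_mul, coeff_twistPoly_self,
      mul_neg, Finset.sum_neg_distrib, dotProduct]
  rwa [hP, Polynomial.coeff_zero, zero_eq_neg] at hcoeff

theorem span_twistVec_compl (p : ℂ) (S : Finset ℂ) :
    Submodule.span ℂ (twistVec p '' (S : Set ℂ)ᶜ) = (⊤ : Submodule ℂ (Fin n → ℂ)) := by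
  by_contra hlt
  obtain ⟨f, hf, hker⟩ := Submodule.exists_le_ker_of_lt_top _ (lt_top_iff_ne_top.2 hlt)
  obtain ⟨r, rfl⟩ := (dotProductEquiv ℂ (Fin n)).surjective f
  have hnode (z : ℂ) (hz : z ∉ S) : r ⬝ᵥ twistVec p z = 0 :=
    hker (Submodule.subset_span ⟨z, hz, rfl⟩)
  let ν := S.finite_toSet.infinite_compl.natEmbedding
  have hν : Function.Injective fun i : Fin n => (ν i : ℂ) :=
    Subtype.val_injective.comp (ν.injective.comp Fin.val_injective)
  have hzero := eq_zero_of_dotProduct_twistVec hν (dotProduct_lastVec_eq_zero hnode)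
    fun i => hnode _ (ν i).2
  rw [hzero, map_zero] at hf
  exact hf rfl

theorem linearMap_ext_twistVec {W : Type*} [AddCommGroup W] [Module ℂ W] (p : ℂ) (S : Finset ℂ)
    {f g : (Fin n → ℂ) →ₗ[ℂ] W} (h : ∀ z ∉ S, f (twistVec p z) = g (twistVec p z)) : f = g :=
  LinearMap.ext_on (span_twistVec_compl p S) (Set.forall_mem_image.2 h)

theorem ext_mulVec_twistVec_tmul (p q r : ℂ) {M N : Mat3 n}
    (h : ∀ X Y Z : ℂ, X ≠ Y → X ≠ Z → Y ≠ Z →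
      M *ᵥ (twistVec p X ⊠ twistVec q Y ⊠ twistVec r Z) =
        N *ᵥ (twistVec p X ⊠ twistVec q Y ⊠ twistVec r Z)) : M = N := by
  have hZ (X Y : ℂ) (hXY : X ≠ Y) :
      M.mulVecLin ∘ₗ tmul (twistVec p X) ∘ₗ tmul (twistVec q Y) =
        N.mulVecLin ∘ₗ tmul (twistVec p X) ∘ₗ tmul (twistVec q Y) :=
    linearMap_ext_twistVec r {X, Y} fun Z hZ => by
      rw [Finset.mem_insert, Finset.mem_singleton, not_or] at hZ
      exact h X Y Z hXY (Ne.symm hZ.1) (Ne.symm hZ.2)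
  have hY (X : ℂ) (z : Fin n → ℂ) :
      M.mulVecLin ∘ₗ tmul (twistVec p X) ∘ₗ tmul.flip z =
        N.mulVecLin ∘ₗ tmul (twistVec p X) ∘ₗ tmul.flip z :=
    linearMap_ext_twistVec q {X} fun Y hY =>
      LinearMap.congr_fun (hZ X Y (Ne.symm (Finset.notMem_singleton.1 hY))) z
  have hX (y z : Fin n → ℂ) :
      M.mulVecLin ∘ₗ tmul.flip (y ⊠ z) = N.mulVecLin ∘ₗ tmul.flip (y ⊠ z) :=
    linearMap_ext_twistVec p ∅ fun X _ => LinearMap.congr_fun (hY X z) y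
  refine ext_mulVec_single_tmul_single fun i t => ?_
  rw [← single_tmul_single]
  exact LinearMap.congr_fun (hX (Pi.single t.1 1) (Pi.single t.2 1)) (Pi.single i 1)

section LegsOnTwistVec

variable {γ s p q p' q' X Y : ℂ} (hs : s * (p - q - γ) = γ) (hp : p' = p - γ) (hq : q' = q + γ)
  (hXY : X ≠ Y) (z : Fin n → ℂ)

include hs hp hq hXY

theorem leg12_polyR_mulVec :
    leg12 (polyR n γ s p q) *ᵥ (twistVec p' X ⊠ twistVec q' Y ⊠ z) =
      (1 + γ / (X - Y)) • (twistVec p X ⊠ twistVec q Y ⊠ z) +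
        (s - γ / (X - Y)) • (twistVec p Y ⊠ twistVec q X ⊠ z) := by
  rw [hp, hq, leg12_mulVec_tmul, polyR_mulVec_of_ne hs hXY]
  ext t
  simp only [Function.comp_apply, Pi.add_apply, Pi.smul_apply, tmul_apply, smul_eq_mul,
    Equiv.prodAssoc_symm_apply]
  ring

theorem leg13_polyR_mulVec :
    leg13 (polyR n γ s p q) *ᵥ (twistVec p' X ⊠ z ⊠ twistVec q' Y) =
      (1 + γ / (X - Y)) • (twistVec p X ⊠ z ⊠ twistVec q Y) +
        (s - γ / (X - Y)) • (twistVec p Y ⊠ z ⊠ twistVec q X) := by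
  rw [hp, hq, leg13_mulVec_tmul, polyR_mulVec_of_ne hs hXY]
  ext t
  simp only [Function.comp_apply, Pi.add_apply, Pi.smul_apply, tmul_apply, smul_eq_mul,
    swap12, Equiv.coe_fn_mk]
  ring

theorem leg23_polyR_mulVec :
    leg23 (polyR n γ s p q) *ᵥ (z ⊠ twistVec p' X ⊠ twistVec q' Y) =
      (1 + γ / (X - Y)) • (z ⊠ twistVec p X ⊠ twistVec q Y) +
        (s - γ / (X - Y)) • (z ⊠ twistVec p Y ⊠ twistVec q X) := by
  rw [hp, hq, leg23_mulVec_tmul, polyR_mulVec_of_ne hs hXY, map_add, map_smul, map_smul]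

end LegsOnTwistVec

variable {u v w : ℂ}

theorem polyR_yang_baxter_mulVec (γ : ℂ) (huv : u ≠ v) (huw : u ≠ w) (hvw : v ≠ w) {X Y Z : ℂ}
    (hXY : X ≠ Y) (hXZ : X ≠ Z) (hYZ : Y ≠ Z) :
    (leg12 (polyR n γ (γ / (u - v)) (u + γ) v) * leg13 (polyR n γ (γ / (u - w)) u (w - γ)) *
      leg23 (polyR n γ (γ / (v - w)) (v + γ) w)) *ᵥ
        (twistVec (u - γ) X ⊠ twistVec v Y ⊠ twistVec (w + γ) Z) =
    (leg23 (polyR n γ (γ / (v - w)) v (w - γ)) * leg13 (polyR n γ (γ / (u - w)) (u + γ) w) *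
      leg12 (polyR n γ (γ / (u - v)) u (v - γ))) *ᵥ
        (twistVec (u - γ) X ⊠ twistVec v Y ⊠ twistVec (w + γ) Z) := by
  have hs {a b : ℂ} (hab : a ≠ b) : γ / (a - b) * (a + γ - b - γ) = γ := by
    rw [add_sub_right_comm, add_sub_cancel_right, div_mul_cancel₀ _ (sub_ne_zero.2 hab)]
  have hs' {a b : ℂ} (hab : a ≠ b) : γ / (a - b) * (a - (b - γ) - γ) = γ := by
    rw [sub_sub, sub_add_cancel, div_mul_cancel₀ _ (sub_ne_zero.2 hab)]
  have hp {a : ℂ} : a = a + γ - γ := (add_sub_cancel_right a γ).symm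
  have hq {a : ℂ} : a = a - γ + γ := (sub_add_cancel a γ).symm
  simp only [← Matrix.mulVec_mulVec]
  rw [leg23_polyR_mulVec (hs hvw) hp rfl hYZ, leg12_polyR_mulVec (hs' huv) rfl hq hXY]
  simp only [Matrix.mulVec_add, Matrix.mulVec_smul]
  rw [leg13_polyR_mulVec (hs' huw) rfl hq hXZ, leg13_polyR_mulVec (hs' huw) rfl hq hXY,
    leg13_polyR_mulVec (hs huw) hp rfl hXZ, leg13_polyR_mulVec (hs huw) hp rfl hYZ]
  simp only [Matrix.mulVec_add, Matrix.mulVec_smul]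
  rw [leg12_polyR_mulVec (hs huv) hp rfl hXY, leg12_polyR_mulVec (hs huv) hp rfl hYZ.symm,
    leg12_polyR_mulVec (hs huv) hp rfl hXZ, leg12_polyR_mulVec (hs huv) hp rfl hYZ,
    leg23_polyR_mulVec (hs' hvw) rfl hq hYZ, leg23_polyR_mulVec (hs' hvw) rfl hq hXY.symm,
    leg23_polyR_mulVec (hs' hvw) rfl hq hXZ, leg23_polyR_mulVec (hs' hvw) rfl hq hXY]
  replace huv := sub_ne_zero.2 huv
  replace huw := sub_ne_zero.2 huw
  replace hvw := sub_ne_zero.2 hvw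
  have hYX := sub_ne_zero.2 hXY.symm
  have hZY := sub_ne_zero.2 hYZ.symm
  replace hXY := sub_ne_zero.2 hXY
  replace hXZ := sub_ne_zero.2 hXZ
  replace hYZ := sub_ne_zero.2 hYZ
  match_scalars <;> field_simp <;> ring

theorem polyR_yang_baxter (γ : ℂ) (huv : u ≠ v) (huw : u ≠ w) (hvw : v ≠ w) :
    leg12 (polyR n γ (γ / (u - v)) (u + γ) v) * leg13 (polyR n γ (γ / (u - w)) u (w - γ)) *
      leg23 (polyR n γ (γ / (v - w)) (v + γ) w) =
    leg23 (polyR n γ (γ / (v - w)) v (w - γ)) * leg13 (polyR n γ (γ / (u - w)) (u + γ) w) *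
      leg12 (polyR n γ (γ / (u - v)) u (v - γ)) :=
  ext_mulVec_twistVec_tmul (u - γ) v (w + γ) fun _ _ _ hXY hXZ hYZ =>
    polyR_yang_baxter_mulVec γ huv huw hvw hXY hXZ hYZ

theorem gauge_kronecker_mul_gConj2_R0 (hn : 1 ≤ n) {γ : ℂ} (hu : u ≠ 0) (hv : v - γ ≠ 0) :
    (gauge n u ⊗ₖ gauge n (v - γ)) * gConj2 γ 1 (R0 n γ) u v =
      polyR n γ (γ / (u - v)) u (v - γ) * (gauge n (u - γ) ⊗ₖ gauge n v) := by
  have h := gauge_kronecker_mul_R0 (n := n) (u := u - γ) (v := v - γ) (γ := γ) hn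
    (by rwa [sub_add_cancel]) hv
  rw [sub_add_cancel, sub_add_cancel, sub_sub_sub_cancel_right] at h
  simpa only [gConj2, one_mul] using h

theorem R0_yang_baxter (hn : 1 ≤ n) {γ : ℂ} (huv : u ≠ v) (huw : u ≠ w) (hvw : v ≠ w) (hu : u ≠ 0)
    (hu' : u + γ ≠ 0) (hv : v ≠ 0) (hv' : v + γ ≠ 0) (hv'' : v - γ ≠ 0) (hw : w ≠ 0)
    (hw' : w - γ ≠ 0) :
    leg12 (R0 n γ u v) * leg13 (gConj2 γ 1 (R0 n γ) u w) * leg23 (R0 n γ v w) =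
      leg23 (gConj2 γ 1 (R0 n γ) v w) * leg13 (R0 n γ u w) *
        leg12 (gConj2 γ 1 (R0 n γ) u v) := by
  have h12 := kronecker_mul_leg12 (gauge_kronecker_mul_R0 hn hu' hv) (gauge n (w - γ))
  have h13 := kronecker_mul_leg13 (gauge_kronecker_mul_gConj2_R0 hn hu hw') (gauge n (v + γ))
  have h23 := kronecker_mul_leg23 (gauge_kronecker_mul_R0 hn hv' hw) (gauge n (u - γ))
  have h23' := kronecker_mul_leg23 (gauge_kronecker_mul_gConj2_R0 hn hv hw') (gauge n (u + γ))
  have h13' := kronecker_mul_leg13 (gauge_kronecker_mul_R0 hn hu' hw) (gauge n (v - γ))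
  have h12' := kronecker_mul_leg12 (gauge_kronecker_mul_gConj2_R0 hn hu hv'') (gauge n (w + γ))
  have hunit := Matrix.IsUnit.kronecker (isUnit_gauge (n := n) hu')
    (Matrix.IsUnit.kronecker (isUnit_gauge (n := n) hv) (isUnit_gauge (n := n) hw'))
  refine hunit.mul_left_cancel ?_
  rw [← mul_assoc, ← mul_assoc, h12, mul_assoc (leg12 _), h13, ← mul_assoc, mul_assoc _ _ (leg23 _),
    h23, ← mul_assoc, polyR_yang_baxter γ huv huw hvw, ← mul_assoc, ← mul_assoc, h23',
    mul_assoc (leg23 _) _ (leg13 _), h13', ← mul_assoc, mul_assoc _ _ (leg12 (gConj2 _ _ _ _ _)),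
    h12', ← mul_assoc]

end YangBaxter

end ACF

end

theorem mainTheorem3 (n : ℕ) (hn : 1 ≤ n) (γ : ℂ) (hγ : γ ≠ 0) :
    -- the twist is invertible
    (∀ (f0 : ℂ → ℂ) (u : ℂ) (lam : Fin n → ℂ), Function.Injective lam → u + γ ≠ 0 →
      ACF.sigma lam + u + f0 (ACF.sigma lam + u) ≠ 0 →
      IsUnit (ACF.twist γ f0 u lam)) ∧
    -- parametrization of `B` and of `C₁₂ = B₂₁`
    (∀ (f0 : ℂ → ℂ) (u : ℂ) (lam : Fin n → ℂ), ACF.Generic γ lam → u + γ ≠ 0 →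
      ACF.sigma lam + u + f0 (ACF.sigma lam + u) ≠ 0 →
      ACF.B γ u lam = ACF.sp2 (ACF.twist γ f0 u lam)⁻¹ *
        ACF.dyn2h1 γ (ACF.gConj γ 1 (ACF.twist γ f0) u) lam ∧
      ACF.C γ u lam = ACF.sp1 (ACF.twist γ f0 u lam)⁻¹ *
        ACF.dyn1h2 γ (ACF.gConj γ 1 (ACF.twist γ f0) u) lam) ∧
    -- parametrization of `A`
    (∀ (f0 u v : ℂ) (lam : Fin n → ℂ), Function.Injective lam →
      u ≠ v → u + γ ≠ 0 → v ≠ 0 →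
      ACF.sigma lam + u + f0 ≠ 0 → ACF.sigma lam + v + f0 ≠ 0 →
      ACF.sigma lam + u - γ + f0 ≠ 0 → ACF.sigma lam + v - γ + f0 ≠ 0 →
      ACF.A γ u v lam =
        ACF.sp1 (ACF.twist γ (fun _ => f0) u lam)⁻¹ *
        ACF.sp2 (ACF.gConj γ 1 (ACF.twist γ (fun _ => f0)) v lam)⁻¹ *
        ACF.R γ f0 u v lam *
        ACF.sp1 (ACF.gConj γ 1 (ACF.twist γ (fun _ => f0)) u lam) *
        ACF.sp2 (ACF.twist γ (fun _ => f0) v lam)) ∧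
    -- parametrization of `D`
    (∀ (f0 u v : ℂ) (lam : Fin n → ℂ), ACF.Generic γ lam →
      u ≠ v → u ≠ 0 → v ≠ 0 →
      ACF.sigma lam + u + f0 ≠ 0 → ACF.sigma lam + v + f0 ≠ 0 →
      ACF.sigma lam + u - γ + f0 ≠ 0 → ACF.sigma lam + v - γ + f0 ≠ 0 →
      ACF.D γ (u - v) lam =
        ACF.dyn1h2 γ (fun mu => (ACF.gConj γ 1 (ACF.twist γ (fun _ => f0)) u mu)⁻¹) lam *
        ACF.sp2 (ACF.gConj γ 1 (ACF.twist γ (fun _ => f0)) v lam)⁻¹ *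
        ACF.R γ f0 u v lam *
        ACF.sp1 (ACF.gConj γ 1 (ACF.twist γ (fun _ => f0)) u lam) *
        ACF.dyn2h1 γ (ACF.gConj γ 1 (ACF.twist γ (fun _ => f0)) v) lam) ∧
    -- `R` is quasi non-dynamical: `R₁₂ = R₁₂^{gg}(h₃)`
    (∀ (f0 u v : ℂ) (lam : Fin n → ℂ), u ≠ v →
      ACF.sigma lam + u + f0 ≠ 0 → ACF.sigma lam + v - γ + f0 ≠ 0 →
      ACF.leg12 (ACF.R γ f0 u v lam) =
        ACF.dyn12h3 γ (ACF.gConj2 γ 1 (ACF.R γ f0) u v) lam) ∧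
    -- for `f₀ = γ`: `R = exp(-(σ/γ)(log g₁ + log g₂)) R⁰ exp((σ/γ)(log g₁ + log g₂))`
    (∀ (u v : ℂ) (lam : Fin n → ℂ), u ≠ v →
      ACF.sigma lam + u + γ ≠ 0 → ACF.sigma lam + v ≠ 0 →
      ACF.R γ γ u v lam = ACF.gConj2 γ (-(ACF.sigma lam / γ)) (ACF.R0 n γ) u v) ∧
    -- `R⁰` depends on `u` and `v` separately, not only through `u - v`
    (¬ ∃ F : ℂ → ACF.Mat2 n, ∀ u v : ℂ, u ≠ v → u + γ ≠ 0 → v ≠ 0 →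
      ACF.R0 n γ u v = F (u - v)) ∧
    -- the `g`-deformed Yang-Baxter equation for `R⁰`
    (∀ u v w : ℂ, u ≠ v → u ≠ w → v ≠ w →
      u ≠ 0 → u + γ ≠ 0 → v ≠ 0 → v + γ ≠ 0 → v - γ ≠ 0 → w ≠ 0 → w - γ ≠ 0 →
      ACF.leg12 (ACF.R0 n γ u v) *
        ACF.leg13 (ACF.gConj2 γ 1 (ACF.R0 n γ) u w) *
        ACF.leg23 (ACF.R0 n γ v w) =
      ACF.leg23 (ACF.gConj2 γ 1 (ACF.R0 n γ) v w) *
        ACF.leg13 (ACF.R0 n γ u w) *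
        ACF.leg12 (ACF.gConj2 γ 1 (ACF.R0 n γ) u v)) :=
  ⟨fun _ _ _ h hu hU => ACF.isUnit_twist h hu hU,
    fun _ _ _ h hu hU => ⟨ACF.B_eq hγ h hu hU, ACF.C_eq hγ h hu hU⟩,
    fun _ _ _ _ h huv hu hv hU hV hU' hV' => ACF.A_eq h huv hu hv hU hV hU' hV',
    fun _ _ _ _ h huv hu hv hU hV hU' hV' => ACF.D_eq hγ h huv hu hv hU hV hU' hV',
    fun f0 u v lam _ _ _ => ACF.leg12_R_eq_dyn12h3 γ f0 u v lam,
    fun _ _ _ _ hU hW => ACF.R_eq_gConj2_R0 hn hγ hU hW,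
    ACF.not_exists_R0_eq_sub hn hγ,
    fun _ _ _ huv huw hvw hu hu' hv hv' hv'' hw hw' =>
      ACF.R0_yang_baxter hn huv huw hvw hu hu' hv hv' hv'' hw hw'⟩
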